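/- Let $d\ge 2$, $s\ge 1$, $n\ge 1$ be integers, $\beta>-d-s$, $\lambda_0,\dots,\lambda_{s-1}>0$, and let $\eta\in C^\infty([0,\infty))$ satisfy $\eta=1$ on $[0,1]$ and $\eta=0$ on $(2,\infty)$. Let $\mathbb V_0^{d+1}=\{(x,t)\in\mathbb R^d\times[0,1]:\|x\|=t\}$, write $\int_{\mathbb V_0^{d+1}} g\,d\mathsf m=\int_0^1t^{d-1}\int_{\mathbb S^{d-1}}g(t\xi,t)\,d\sigma(\xi)\,dt$, let $\omega_d=\sigma(\mathbb S^{d-1})$, and let $\partial_t$ be the partial derivative in the last variable ($x$ fixed). Put $$\langle f,g\rangle_{\beta,\gamma}=b_{\beta,\gamma}\int_{\mathbb V_0^{d+1}}fg\,t^\beta(1-t)^\gamma\,d\mathsf m\quad(\beta>-d,\ \gamma>-1),\qquad \langle 1,1\rangle_{\beta,\gamma}=1,$$ $$\langle f,g\rangle_{\beta,-s}=\frac1{\omega_d}\int_{\mathbb V_0^{d+1}}\partial_t^sf\,\partial_t^sg\;t^{\beta+s}\,d\mathsf m+\sum_{k=0}^{s-1}\frac{\lambda_k}{\omega_d}\int_{\mathbb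 S^{d-1}}\partial_t^kf(\xi,1)\,\partial_t^kg(\xi,1)\,d\sigma(\xi).$$ A polynomial of degree at most $n$ on the cone is always written as a linear combination of functions $t^jY(x)$, where $Y$ is a solid harmonic (a homogeneous harmonic polynomial) of degree $m$ and $j+m\le n$; this representation is unique, and $\partial_t$ and values off the cone refer to it. For either inner product, the orthogonal polynomials of degree $n$ are those polynomials of degree at most $n$ that are orthogonal to all polynomials of degree at most $n-1$; let $\operatorname{proj}_n^{\beta,\gamma}$ and $\operatorname{proj}_n^{\beta,-s}$ denote the orthogonal projections onto these spaces. Let $\operatorname{proj}_j^{\mathbb S^{d-1}}$ be the $L^2(\mathbb S^{d-1})$-orthogonal projection onto the spherical harmonics of degree $j$, its values being extended to $\mathbb R^d$ as solid harmonics of degree $j$. Define $$\mathsf Q_{n,\eta}^{(\beta,-s)}f=\sum_{k=0}^{2n}\eta\Big(\frac kn\Big)\operatorname{proj}_k^{\beta,-s}f,\qquad \mathsf Q_{n-s,\eta}^{(\beta+s,0)}g=\sum_{j=0}^{2n-s}\eta\Big(\frac{j+s}n\Big)\operatorname{proj}_j^{\beta+s,0}g,$$ $$\mathsf Q_{n-m,\eta}^{\mathbb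 S^{d-1}}g=\sum_{j=0}^{2n-m}\eta\Big(\frac{j+m}n\Big)\operatorname{proj}_j^{\mathbb S^{d-1}}g$$ (empty sums are $0$). **Theorem.** Let $f$ be of class $C^s$ on an open neighbourhood of $\{(x,t):\|x\|\le t\le1\}$. Then, for every $(x,t)\in\mathbb V_0^{d+1}$, $$\begin{aligned}f(x,t)-\mathsf Q_{n,\eta}^{(\beta,-s)}f(x,t)=\;&\sum_{m=0}^{s-1}\frac{(t-1)^m}{m!}\Big[\partial_t^mf(x,1)-\mathsf Q_{n-m,\eta}^{\mathbb S^{d-1}}\big[\partial_t^mf(\cdot,1)\big](x)\Big]\\&+(-1)^s\int_t^1\frac{(v-t)^{s-1}}{(s-1)!}\Big[\partial_t^sf(x,v)-\mathsf Q_{n-s,\eta}^{(\beta+s,0)}\big(\partial_t^sf\big)(x,v)\Big]\,dv.\end{aligned}$$ -/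

import Mathlib

open scoped ContDiff

noncomputable section

namespace ConeSobolev

open MeasureTheory

/-- Euclidean space `ℝ^d`. -/
abbrev E (d : ℕ) : Type := EuclideanSpace ℝ (Fin d)

/-- The conic surface `V_0^{d+1} = {(x,t) : ‖x‖ = t, 0 ≤ t ≤ 1}`. -/
def cone (d : ℕ) : Set (E d × ℝ) := {p | ‖p.1‖ = p.2 ∧ 0 ≤ p.2 ∧ p.2 ≤ 1}

/-- The solid cone `{(x,t) : ‖x‖ ≤ t ≤ 1}`. -/
def solidCone (d : ℕ) : Set (E d × ℝ) := {p | ‖p.1‖ ≤ p.2 ∧ p.2 ≤ 1}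

/-- `∂_t^k f`, where `∂_t` is the partial derivative in the last variable (`x` is kept fixed). -/
def tderiv {d : ℕ} (k : ℕ) (f : E d × ℝ → ℝ) : E d × ℝ → ℝ :=
  fun p => iteratedDeriv k (fun τ => f (p.1, τ)) p.2

/-! ### The unit sphere and spherical harmonics -/

/-- The surface measure `σ` of the unit sphere of `ℝ^d`. -/
def sphMeasure (d : ℕ) : Measure (Metric.sphere (0 : E d) 1) :=
  (volume : Measure (E d)).toSphere

/-- `∫_{S^{d-1}} g dσ` for a function `g` that is defined on `ℝ^d`. -/
def sphInt (d : ℕ) (g : E d → ℝ) : ℝ := ∫ ξ, g (ξ : E d) ∂(sphMeasure d)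

/-- The surface area `ω_d` of the unit sphere. -/
def sphArea (d : ℕ) : ℝ := (sphMeasure d).real Set.univ

/-- The normalized `L²` inner product of the unit sphere. -/
def sphInner (d : ℕ) (g h : E d → ℝ) : ℝ := (1 / sphArea d) * sphInt d (fun ξ => g ξ * h ξ)

/-- The Laplace operator on polynomials in `d` variables. -/
def laplacian (d : ℕ) (P : MvPolynomial (Fin d) ℝ) : MvPolynomial (Fin d) ℝ :=
  ∑ i, MvPolynomial.pderiv i (MvPolynomial.pderiv i P)

/-- The solid harmonics of degree `m`, as functions on `ℝ^d`: homogeneous polynomials of degree `m`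
that are annihilated by the Laplace operator. Their restrictions to the unit sphere are the
spherical harmonics of degree `m`; by homogeneity, a spherical harmonic determines its solid
harmonic. -/
def solidHarmonics (d m : ℕ) : Set (E d → ℝ) :=
  {Y | ∃ P : MvPolynomial (Fin d) ℝ, P.IsHomogeneous m ∧ laplacian d P = 0 ∧
    Y = fun x => MvPolynomial.eval (fun i => x i) P}

/-! ### Orthogonal projections -/

open Classical in
/-- The orthogonal projection of `f` onto `V` with respect to the symmetric form `B`: the element
`p` of `V` with `B (f - p) q = 0` for all `q ∈ V` (and `0` if there is no such `p`). -/
def orthProj {X : Type} (B : (X → ℝ) → (X → ℝ) → ℝ) (V : Set (X → ℝ)) (f : X → ℝ) : X → ℝ :=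
  if h : ∃ p ∈ V, ∀ q ∈ V, B (f - p) q = 0 then h.choose else 0

/-- The projection `proj_m^{S^{d-1}}` of `L²(S^{d-1})` onto the spherical harmonics of degree `m`.
The value is given as a solid harmonic, a function on `ℝ^d`; only the values of `g` on the unit
sphere matter. -/
def sphProj (d m : ℕ) (g : E d → ℝ) : E d → ℝ := orthProj (sphInner d) (solidHarmonics d m) g

/-! ### Polynomials and orthogonal polynomials on the conic surface -/

/-- Polynomials of degree less than `N` on the conic surface. On the surface `‖x‖² = t²`, so that
every polynomial has a unique representative that is a sum of products of a power of `t` and a solid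
harmonic in `x`; the derivative `∂_t`, and values off the surface, refer to this representative. -/
def conePoly (d N : ℕ) : Submodule ℝ (E d × ℝ → ℝ) :=
  Submodule.span ℝ {g | ∃ (j m : ℕ) (Y : E d → ℝ), j + m < N ∧ Y ∈ solidHarmonics d m ∧
    g = fun p => p.2 ^ j * Y p.1}

/-- The orthogonal polynomials of degree `n` on the conic surface for the form `B`: polynomials of
degree at most `n` that are orthogonal to all polynomials of lower degree. -/
def orthPoly (d : ℕ) (B : (E d × ℝ → ℝ) → (E d × ℝ → ℝ) → ℝ) (n : ℕ) : Set (E d × ℝ → ℝ) :=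
  {p | p ∈ conePoly d (n + 1) ∧ ∀ q ∈ conePoly d n, B p q = 0}

/-- `∫_{V_0^{d+1}} g dm`. -/
def coneInt (d : ℕ) (g : E d × ℝ → ℝ) : ℝ :=
  ∫ t in (0 : ℝ)..1, t ^ (d - 1) * sphInt d (fun ξ => g (t • ξ, t))

/-- The normalization constant `b_{β,γ} = c_{β+d-1,γ} / ω_d`, for which `⟨1,1⟩_{β,γ} = 1`. -/
def coneConst (d : ℕ) (β γ : ℝ) : ℝ :=
  (1 / sphArea d) * (Real.Gamma (β + d + γ + 1) / (Real.Gamma (β + d) * Real.Gamma (γ + 1)))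

/-- The inner product `⟨f,g⟩_{β,γ}` with the Jacobi weight `t^β (1-t)^γ`. -/
def coneInner (d : ℕ) (β γ : ℝ) (f g : E d × ℝ → ℝ) : ℝ :=
  coneConst d β γ * coneInt d (fun p => f p * g p * (p.2 ^ β * (1 - p.2) ^ γ))

/-- The Sobolev inner product `⟨f,g⟩_{β,-s}` with the constants `lam 0, …, lam (s-1)`. -/
def sobInner (d s : ℕ) (β : ℝ) (lam : ℕ → ℝ) (f g : E d × ℝ → ℝ) : ℝ :=
  (1 / sphArea d) * coneInt d (fun p => tderiv s f p * tderiv s g p * p.2 ^ (β + s)) +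
    ∑ k ∈ Finset.range s,
      (lam k / sphArea d) * sphInt d (fun ξ => tderiv k f (ξ, 1) * tderiv k g (ξ, 1))

/-- The projection `proj_n^{β,γ}` onto the orthogonal polynomials of degree `n`. -/
def coneProj (d : ℕ) (β γ : ℝ) (n : ℕ) (f : E d × ℝ → ℝ) : E d × ℝ → ℝ :=
  orthProj (coneInner d β γ) (orthPoly d (coneInner d β γ) n) f

/-- The projection `proj_n^{β,-s}` onto the Sobolev orthogonal polynomials of degree `n`. -/
def sobProj (d s : ℕ) (β : ℝ) (lam : ℕ → ℝ) (n : ℕ) (f : E d × ℝ → ℝ) : E d × ℝ → ℝ :=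
  orthProj (sobInner d s β lam) (orthPoly d (sobInner d s β lam) n) f

/-! ### Near best approximation operators -/

/-- Admissible cut-off functions on `[0,∞)`: smooth, equal to `1` on `[0,1]`, supported on
`[0,2]`. -/
structure IsAdmissibleCutoff (η : ℝ → ℝ) : Prop where
  smooth : ContDiffOn ℝ ∞ η (Set.Ici 0)
  eq_one : ∀ t, 0 ≤ t → t ≤ 1 → η t = 1
  eq_zero : ∀ t, 2 < t → η t = 0

/-- `Q_{n,η}^{(β,-s)} f = ∑_{k=0}^{2n} η(k/n) proj_k^{β,-s} f`. -/
def sobQ (d s : ℕ) (β : ℝ) (lam : ℕ → ℝ) (η : ℝ → ℝ) (n : ℕ) (f : E d × ℝ → ℝ) : E d × ℝ → ℝ :=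
  ∑ k ∈ Finset.range (2 * n + 1), η ((k : ℝ) / n) • sobProj d s β lam k f

/-- `Q_{n-m,η}^{β,γ} g = ∑_{j=0}^{2n-m} η((j+m)/n) proj_j^{β,γ} g` (zero if `m > 2n`). -/
def coneQ (d : ℕ) (β γ : ℝ) (η : ℝ → ℝ) (n m : ℕ) (g : E d × ℝ → ℝ) : E d × ℝ → ℝ :=
  ∑ j ∈ Finset.range (2 * n + 1 - m), η (((j : ℝ) + m) / n) • coneProj d β γ j g

/-- `Q_{n-m,η}^{S^{d-1}} g = ∑_{j=0}^{2n-m} η((j+m)/n) proj_j^{S^{d-1}} g` (zero if `m > 2n`), as a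
sum of solid harmonics. -/
def sphQ (d : ℕ) (η : ℝ → ℝ) (n m : ℕ) (g : E d → ℝ) : E d → ℝ :=
  ∑ j ∈ Finset.range (2 * n + 1 - m), η (((j : ℝ) + m) / n) • sphProj d j g

end ConeSobolev

end

noncomputable section

namespace ConeSobolev

open MeasureTheory

/-! ### Gaussian integrals of polynomials -/

/-! Consider the data of a function: its derivative `∂_t^s` on the cone, and the traces at t = 1 of
its derivatives of order m < s. The Sobolev form is a direct sum of forms on these data: a positive
multiple of the form with weight t^(β+s), plus λ_m times the L² form of the sphere for each trace
(`sobInner_eq`). By integration in t, polynomials of degree below N realize every choice of data of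
degrees below N - s and N - m (`exists_conePoly_data`), and by Taylor's formula at t = 1 they are
determined by these data. Hence orthogonality decouples, and `proj_k^{β,-s}` acts on the data as
`proj_{k-s}^{β+s,0}` and as the spherical projections of degrees k - m (`sobProj_data`). Summation
against the cut-off, with the degrees shifted, gives the same for `sobQ` (`sobQ_data`). Subtracting
Taylor's formula for `sobQ f` from the one for f, along the vertical segment from (x, t) to (x, 1),
gives the theorem.

That segment leaves the cone for the solid cone, so identities are needed off the surface.
Polynomials are therefore treated as functions on the whole space, and two facts give uniqueness: a
sum of solid harmonics is determined by its values on the unit sphere (`harmonicLT_eq_zero`), and a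
polynomial in the canonical form is determined by its values on the cone (`conePoly_eq_zero`). Both
rest on the orthogonality of spherical harmonics of different degrees, which is proved with Gaussian
integrals: integration by parts on all of ℝ^d has no boundary terms, and polar coordinates carry the
result to the sphere. -/

/-- Evaluation of a polynomial on Euclidean space. -/
def polyFun {d : ℕ} (P : MvPolynomial (Fin d) ℝ) (x : E d) : ℝ :=
  MvPolynomial.eval (fun i => x i) P

/-- The Gaussian weight. -/
def gauss (d : ℕ) (x : E d) : ℝ := Real.exp (-(‖x‖ ^ 2 / 2))

lemma gauss_eq_prod {d : ℕ} (x : E d) : gauss d x = ∏ i, Real.exp (-(1 / 2) * x i ^ 2) := by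
  rw [gauss, ← Real.exp_sum, EuclideanSpace.norm_sq_eq]
  congr 1
  rw [← Finset.mul_sum]
  simp
  ring

lemma contDiff_polyFun {d : ℕ} (P : MvPolynomial (Fin d) ℝ) {k : WithTop ℕ∞} :
    ContDiff ℝ k (polyFun P) := by
  induction P using MvPolynomial.induction_on with
  | C a =>
    have : polyFun (MvPolynomial.C a : MvPolynomial (Fin d) ℝ) = fun _ => a := by
      ext x; simp [polyFun]
    rw [this]
    exact contDiff_const
  | add p q hp hq =>
    have : polyFun (p + q) = fun x => polyFun p x + polyFun q x := by
      ext x; simp [polyFun]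
    rw [this]; exact hp.add hq
  | mul_X p i hp =>
    have : polyFun (p * MvPolynomial.X i) = fun x => polyFun p x * x i := by
      ext x; simp [polyFun]
    rw [this]; exact hp.mul (by fun_prop)

lemma hasLineDerivAt_polyFun {d : ℕ} (P : MvPolynomial (Fin d) ℝ) (i : Fin d) (x : E d) :
    HasLineDerivAt ℝ (polyFun P) (polyFun (MvPolynomial.pderiv i P) x) x
      (EuclideanSpace.single i 1) := by
  unfold HasLineDerivAt
  induction P using MvPolynomial.induction_on with
  | C a => simpa [polyFun] using hasDerivAt_const (0 : ℝ) a
  | add p q hp hq =>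
    simpa [polyFun, Pi.add_def] using hp.add hq
  | mul_X p j hp =>
    have h2 : HasDerivAt (fun t : ℝ => (x + t • EuclideanSpace.single i (1 : ℝ)) j)
        ((EuclideanSpace.single i (1 : ℝ)) j) 0 := by
      simpa using ((hasDerivAt_id (0 : ℝ)).mul_const
        ((EuclideanSpace.single i (1 : ℝ)) j)).const_add (x j)
    have := hp.mul h2
    simp only [polyFun, map_mul, MvPolynomial.eval_X, Pi.mul_def, zero_smul, add_zero,
      Derivation.leibniz, MvPolynomial.pderiv_X, smul_eq_mul, map_add] at this ⊢
    refine this.congr_deriv ?_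
    by_cases hij : j = i
    · subst hij; simp [mul_comm, add_comm]
    · simp [hij, mul_comm]

lemma hasLineDerivAt_gauss {d : ℕ} (i : Fin d) (x : E d) :
    HasLineDerivAt ℝ (gauss d) (-(x i * gauss d x)) x (EuclideanSpace.single i 1) := by
  have h1 : HasFDerivAt (fun x : E d => ‖x‖ ^ 2) (2 • (innerSL ℝ x)) x :=
    (hasStrictFDerivAt_norm_sq x).hasFDerivAt
  have h2 := (h1.const_mul (-1 / 2)).exp.hasLineDerivAt (EuclideanSpace.single i 1)
  have h3 : gauss d = fun x => Real.exp (-1 / 2 * ‖x‖ ^ 2) := by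
    ext y
    simp only [gauss]
    congr 1
    ring
  rw [h3]
  refine HasDerivAt.congr_deriv h2 ?_
  simp [EuclideanSpace.inner_single_right]
  ring

lemma integrable_polyFun_mul_gauss {d : ℕ} (P : MvPolynomial (Fin d) ℝ) :
    Integrable (fun x => polyFun P x * gauss d x) := by
  induction P using MvPolynomial.induction_on' with
  | add p q hp hq =>
    simpa [polyFun, add_mul, Pi.add_def] using hp.add hq
  | monomial u a =>
    rw [← (EuclideanSpace.volume_preserving_symm_measurableEquiv_toLp
      (Fin d)).symm.integrable_comp_emb (MeasurableEquiv.measurableEmbedding _)]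
    have : Integrable (fun x : Fin d → ℝ =>
        a * ∏ i, (x i ^ (u i) * Real.exp (-(1 / 2) * x i ^ 2))) := by
      refine Integrable.const_mul ?_ a
      refine Integrable.fintype_prod
        (f := fun i (y : ℝ) => y ^ (u i) * Real.exp (-(1 / 2) * y ^ 2)) fun i => ?_
      simpa using integrable_rpow_mul_exp_neg_mul_sq (b := 1 / 2) (by norm_num) (s := (u i : ℝ))
        (by have : (0 : ℝ) ≤ u i := by positivity
            linarith)
    refine this.congr (Filter.Eventually.of_forall fun x => ?_)
    simp [polyFun, gauss_eq_prod, MvPolynomial.eval_monomial, Finsupp.prod_fintype,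
      Finset.prod_mul_distrib, mul_assoc]

/-- The Gaussian functional on polynomials. -/
def gaussInt (d : ℕ) : MvPolynomial (Fin d) ℝ →ₗ[ℝ] ℝ where
  toFun P := ∫ x, polyFun P x * gauss d x
  map_add' P Q := by
    rw [← integral_add (integrable_polyFun_mul_gauss P) (integrable_polyFun_mul_gauss Q)]
    simp [polyFun, add_mul]
  map_smul' c P := by
    rw [RingHom.id_apply, smul_eq_mul, ← integral_const_mul]
    simp [polyFun, MvPolynomial.smul_eval, mul_assoc]

/-- Integration by parts: the i-th derivative of the Gaussian weight is -x_i times the weight. -/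
lemma gaussInt_pderiv {d : ℕ} (i : Fin d) (P : MvPolynomial (Fin d) ℝ) :
    gaussInt d (MvPolynomial.pderiv i P) = gaussInt d (MvPolynomial.X i * P) := by
  have key := integral_bilinear_hasLineDerivAt_right_eq_neg_left_of_integrable
    (μ := (volume : Measure (E d))) (B := ContinuousLinearMap.mul ℝ ℝ)
    (f := polyFun P) (f' := polyFun (MvPolynomial.pderiv i P)) (g := gauss d)
    (g' := fun x => -(x i * gauss d x)) (v := EuclideanSpace.single i 1)
    (by simpa using integrable_polyFun_mul_gauss _)
    (by
      have := (integrable_polyFun_mul_gauss (MvPolynomial.X i * P)).neg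
      refine this.congr (Filter.Eventually.of_forall fun x => ?_)
      simp [polyFun]; ring)
    (by simpa using integrable_polyFun_mul_gauss _)
    (fun x _ => hasLineDerivAt_polyFun P i x) (fun x _ => hasLineDerivAt_gauss i x)
  simp only [ContinuousLinearMap.mul_apply', mul_neg, integral_neg, neg_inj] at key
  change ∫ x, _ = ∫ x, _
  rw [← key]
  congr 1 with x
  simp [polyFun]; ring

/-- Integrate ∂_i((∂_i P) Q) by parts and sum over i. The second derivatives add up to ΔP = 0, and
Euler's identity turns ∑ x_i ∂_i P into mP. -/
lemma gaussInt_harmonic {d m : ℕ} {P Q : MvPolynomial (Fin d) ℝ} (hP : P.IsHomogeneous m)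
    (hlap : laplacian d P = 0) :
    m * gaussInt d (P * Q) =
      ∑ i, gaussInt d (MvPolynomial.pderiv i P * MvPolynomial.pderiv i Q) := by
  have h : ∀ i, gaussInt d (MvPolynomial.pderiv i (MvPolynomial.pderiv i P) * Q) +
      gaussInt d (MvPolynomial.pderiv i P * MvPolynomial.pderiv i Q) =
      gaussInt d (MvPolynomial.X i * MvPolynomial.pderiv i P * Q) := fun i => by
    rw [mul_assoc, ← gaussInt_pderiv, ← map_add, Derivation.leibniz]
    congr 1
    simp only [smul_eq_mul]; ring
  have h2 := Finset.sum_congr rfl fun i (_ : i ∈ Finset.univ) => h i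
  rw [Finset.sum_add_distrib, ← map_sum, ← Finset.sum_mul, ← map_sum (gaussInt d) (fun i => _ * Q),
    ← Finset.sum_mul, hP.sum_X_mul_pderiv] at h2
  unfold laplacian at hlap
  rw [hlap] at h2
  simpa [mul_assoc, ← nsmul_eq_mul] using h2.symm

/-- The gradient side of `gaussInt_harmonic` is symmetric in P and Q, so m and l multiply the
pairing to the same value. -/
lemma gaussInt_orthogonal {d m l : ℕ} (hml : m ≠ l) {P Q : MvPolynomial (Fin d) ℝ}
    (hP : P.IsHomogeneous m) (hP0 : laplacian d P = 0)
    (hQ : Q.IsHomogeneous l) (hQ0 : laplacian d Q = 0) : gaussInt d (P * Q) = 0 := by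
  have h1 := gaussInt_harmonic (Q := Q) hP hP0
  have h2 := gaussInt_harmonic (Q := P) hQ hQ0
  rw [mul_comm Q P] at h2
  simp_rw [mul_comm (MvPolynomial.pderiv _ Q)] at h2
  have h3 : ((m : ℝ) - l) * gaussInt d (P * Q) = 0 := by rw [sub_mul, h1, h2, sub_self]
  refine (mul_eq_zero.mp h3).resolve_left (sub_ne_zero.mpr (by exact_mod_cast hml))

lemma polyFun_smul {d m : ℕ} {P : MvPolynomial (Fin d) ℝ} (hP : P.IsHomogeneous m) (r : ℝ)
    (x : E d) : polyFun P (r • x) = r ^ m * polyFun P x := by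
  simp only [polyFun, MvPolynomial.eval_eq', Finset.mul_sum]
  refine Finset.sum_congr rfl fun u hu => ?_
  have hu : ∑ i, u i = m := by
    rw [← hP (MvPolynomial.mem_support_iff.mp hu), Finsupp.weight_apply, Finsupp.sum_fintype]
    · simp
    · simp
  simp only [PiLp.smul_apply, smul_eq_mul, mul_pow, Finset.prod_mul_distrib,
    Finset.prod_pow_eq_pow_sum, hu]
  ring

/-- A Gaussian integral of a homogeneous polynomial is a multiple of an integral over the sphere. -/
lemma gaussInt_eq_sphInt {d m : ℕ} (hd : 2 ≤ d) {P : MvPolynomial (Fin d) ℝ} (hP : P.IsHomogeneous m) :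
    gaussInt d P = sphInt d (polyFun P) *
      ∫ r : Set.Ioi (0 : ℝ), (r : ℝ) ^ m * Real.exp (-((r : ℝ) ^ 2 / 2))
        ∂(Measure.volumeIoiPow (d - 1)) := by
  have : Nonempty (Fin d) := ⟨⟨0, by omega⟩⟩
  have h1 : gaussInt d P = ∫ x : ({(0)}ᶜ : Set (E d)), polyFun P x.1 * gauss d x.1
      ∂((volume : Measure (E d)).comap (↑)) := by
    rw [integral_subtype_comap (measurableSet_singleton _).compl
      fun x => polyFun P x * gauss d x]
    have : (volume : Measure (E d)).restrict {0}ᶜ = volume := by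
      rw [restrict_compl_singleton]
    rw [this]; rfl
  -- By homogeneity P(rξ) = r^m P(ξ), so in polar coordinates the integrand splits into a spherical
  -- and a radial factor.
  have h2 := (volume : Measure (E d)).measurePreserving_homeomorphUnitSphereProd.integral_comp
    (Homeomorph.measurableEmbedding _)
    (fun p => polyFun P (p.1 : E d) * ((p.2 : ℝ) ^ m * Real.exp (-((p.2 : ℝ) ^ 2 / 2))))
  rw [integral_prod_mul (fun ξ : Metric.sphere (0 : E d) 1 => polyFun P (ξ : E d))
    (fun r : Set.Ioi (0 : ℝ) => (r : ℝ) ^ m * Real.exp (-((r : ℝ) ^ 2 / 2)))] at h2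
  simp only [finrank_euclideanSpace, Fintype.card_fin] at h2
  rw [h1, sphInt, sphMeasure, ← h2]
  congr 1 with x
  have hx : ‖(x : E d)‖ ≠ 0 := norm_ne_zero_iff.mpr x.2
  simp only [homeomorphUnitSphereProd_apply_fst_coe, homeomorphUnitSphereProd_apply_snd_coe,
    polyFun_smul hP, gauss]
  rw [mul_mul_mul_comm, mul_comm (_ ^ m), ← mul_assoc, inv_pow]
  field_simp

/-- Only nonvanishing is needed, to cancel the radial factor in `gaussInt_eq_sphInt`. The measure
has density y^k. -/
lemma radial_integral_pos (k m : ℕ) :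
    0 < ∫ r : Set.Ioi (0 : ℝ), (r : ℝ) ^ m * Real.exp (-((r : ℝ) ^ 2 / 2))
        ∂(Measure.volumeIoiPow k) := by
  have hint : IntegrableOn (fun y : ℝ => y ^ k * (y ^ m * Real.exp (-(y ^ 2 / 2))))
      (Set.Ioi 0) := by
    have := integrableOn_rpow_mul_exp_neg_mul_sq (b := 1 / 2) (by norm_num) (s := ((k + m : ℕ) : ℝ))
      (by have : (0 : ℝ) ≤ (k + m : ℕ) := by positivity
          linarith)
    refine this.congr_fun (fun y _ => ?_) measurableSet_Ioi
    simp only [Real.rpow_natCast, pow_add, mul_assoc]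
    congr 4
    ring
  have h1 : ∫ r : Set.Ioi (0 : ℝ), (r : ℝ) ^ m * Real.exp (-((r : ℝ) ^ 2 / 2))
        ∂(Measure.volumeIoiPow k) =
      ∫ y in Set.Ioi (0 : ℝ), y ^ k * (y ^ m * Real.exp (-(y ^ 2 / 2))) := by
    simp only [Measure.volumeIoiPow, ENNReal.ofReal]
    rw [integral_withDensity_eq_integral_smul,
      integral_subtype_comap measurableSet_Ioi
        fun a : ℝ => Real.toNNReal (a ^ k) • (a ^ m * Real.exp (-(a ^ 2 / 2))),
      setIntegral_congr_fun measurableSet_Ioi fun x hx => ?_]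
    · rw [NNReal.smul_def, Real.coe_toNNReal _ (pow_nonneg (le_of_lt hx) _), smul_eq_mul]
    · exact (measurable_subtype_coe.pow_const _).real_toNNReal
  rw [h1, setIntegral_pos_iff_support_of_nonneg_ae _ hint]
  · rw [Set.inter_eq_self_of_subset_right]
    · simp
    · intro y hy
      have : (0 : ℝ) < y := hy
      rw [Function.mem_support]
      positivity
  · filter_upwards [ae_restrict_mem measurableSet_Ioi] with y hy
    have : (0 : ℝ) < y := hy
    simp only [Pi.zero_apply]
    positivity

lemma sphInt_polyFun_orthogonal {d m l : ℕ} (hd : 2 ≤ d) (hml : m ≠ l) {P Q : MvPolynomial (Fin d) ℝ}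
    (hP : P.IsHomogeneous m) (hP0 : laplacian d P = 0)
    (hQ : Q.IsHomogeneous l) (hQ0 : laplacian d Q = 0) : sphInt d (polyFun (P * Q)) = 0 := by
  have h := gaussInt_orthogonal hml hP hP0 hQ hQ0
  rw [gaussInt_eq_sphInt hd (hP.mul hQ)] at h
  exact (mul_eq_zero.mp h).resolve_right (radial_integral_pos _ _).ne'

/-! ### Orthogonal projections for symmetric forms -/

/-- `B` is a symmetric bilinear form on the space `W` of functions. -/
structure IsForm {X : Type} (B : (X → ℝ) → (X → ℝ) → ℝ) (W : Submodule ℝ (X → ℝ)) : Prop where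
  symm : ∀ f g, B f g = B g f
  add_left : ∀ f ∈ W, ∀ g ∈ W, ∀ h ∈ W, B (f + g) h = B f h + B g h
  smul_left : ∀ (c : ℝ), ∀ f ∈ W, ∀ h ∈ W, B (c • f) h = c * B f h

namespace IsForm

variable {X : Type} {B : (X → ℝ) → (X → ℝ) → ℝ} {W V : Submodule ℝ (X → ℝ)} {f g h : X → ℝ}

lemma add_right (hB : IsForm B W) (hf : f ∈ W) (hg : g ∈ W) (hh : h ∈ W) :
    B f (g + h) = B f g + B f h := by
  rw [hB.symm, hB.add_left _ hg _ hh _ hf, hB.symm g, hB.symm h]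

lemma smul_right (hB : IsForm B W) (c : ℝ) (hf : f ∈ W) (hg : g ∈ W) :
    B f (c • g) = c * B f g := by
  rw [hB.symm, hB.smul_left _ _ hg _ hf, hB.symm g]

lemma zero_left (hB : IsForm B W) (hf : f ∈ W) : B 0 f = 0 := by
  simpa using hB.smul_left 0 0 W.zero_mem f hf

lemma zero_right (hB : IsForm B W) (hf : f ∈ W) : B f 0 = 0 := by
  rw [hB.symm, hB.zero_left hf]

lemma sub_left (hB : IsForm B W) (hf : f ∈ W) (hg : g ∈ W) (hh : h ∈ W) :
    B (f - g) h = B f h - B g h := by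
  have := hB.add_left f hf _ (W.smul_mem (-1) hg) h hh
  rw [hB.smul_left _ _ hg _ hh] at this
  rw [sub_eq_add_neg, ← neg_one_smul ℝ g, this]
  ring

/-- Definiteness makes the map from V to its dual injective, hence surjective in finite dimension; p
represents the functional q ↦ B f q. -/
lemma exists_proj (hB : IsForm B W) (hV : V ≤ W) [FiniteDimensional ℝ V]
    (hdef : ∀ f ∈ V, B f f = 0 → f = 0) (hf : f ∈ W) :
    ∃ p ∈ V, ∀ q ∈ V, B (f - p) q = 0 := by
  let Φ : V →ₗ[ℝ] Module.Dual ℝ V := LinearMap.mk₂ ℝ (fun p q => B p q)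
    (fun p p' q => hB.add_left _ (hV p.2) _ (hV p'.2) _ (hV q.2))
    (fun c p q => hB.smul_left c _ (hV p.2) _ (hV q.2))
    (fun p q q' => hB.add_right (hV p.2) (hV q.2) (hV q'.2))
    (fun c p q => hB.smul_right c (hV p.2) (hV q.2))
  have hinj : Function.Injective Φ := by
    rw [← LinearMap.ker_eq_bot, LinearMap.ker_eq_bot']
    intro p hp
    exact Subtype.ext (hdef p p.2 (by simpa [Φ] using LinearMap.congr_fun hp p))
  have hsurj : Function.Surjective Φ :=
    (LinearMap.injective_iff_surjective_of_finrank_eq_finrank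
      (Subspace.dual_finrank_eq (K := ℝ) (V := V)).symm).mp hinj
  let ℓ : Module.Dual ℝ V :=
    { toFun := fun q => B f q
      map_add' := fun q q' => hB.add_right hf (hV q.2) (hV q'.2)
      map_smul' := fun c q => hB.smul_right c hf (hV q.2) }
  obtain ⟨p, hp⟩ := hsurj ℓ
  refine ⟨p, p.2, fun q hq => ?_⟩
  have := LinearMap.congr_fun hp ⟨q, hq⟩
  rw [hB.sub_left hf (hV p.2) (hV hq)]
  exact sub_eq_zero.mpr this.symm

lemma orthProj_spec (hB : IsForm B W) (hV : V ≤ W) [FiniteDimensional ℝ V]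
    (hdef : ∀ f ∈ V, B f f = 0 → f = 0) (hf : f ∈ W) :
    orthProj B V f ∈ V ∧ ∀ q ∈ V, B (f - orthProj B V f) q = 0 := by
  have h : ∃ p ∈ (V : Set (X → ℝ)), ∀ q ∈ (V : Set (X → ℝ)), B (f - p) q = 0 :=
    hB.exists_proj hV hdef hf
  rw [orthProj, dif_pos h]
  exact h.choose_spec

/-- Two candidates differ by an element of V that is orthogonal to itself. This identifies the
element selected by choice in `orthProj`. -/
lemma orthProj_eq (hB : IsForm B W) (hV : V ≤ W)
    (hdef : ∀ f ∈ V, B f f = 0 → f = 0) (hf : f ∈ W) {p : X → ℝ} (hp : p ∈ V)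
    (hpq : ∀ q ∈ V, B (f - p) q = 0) : orthProj B V f = p := by
  have h : ∃ p ∈ (V : Set (X → ℝ)), ∀ q ∈ (V : Set (X → ℝ)), B (f - p) q = 0 := ⟨p, hp, hpq⟩
  rw [orthProj, dif_pos h]
  obtain ⟨h1, h2⟩ := h.choose_spec
  set p' := h.choose
  have h1 : p' ∈ V := h1
  refine sub_eq_zero.mp (hdef _ (V.sub_mem h1 hp) ?_)
  have hq := V.sub_mem h1 hp
  have e1 := h2 _ hq
  have e2 := hpq _ hq
  rw [hB.sub_left hf (hV h1) (hV hq)] at e1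
  rw [hB.sub_left hf (hV hp) (hV hq)] at e2
  rw [hB.sub_left (hV h1) (hV hp) (hV hq)]
  linarith

end IsForm

/-! ### Solid harmonics -/

/-- The solid harmonics of degree `m` as a subspace. -/
def harmonicSubmodule (d m : ℕ) : Submodule ℝ (E d → ℝ) where
  carrier := solidHarmonics d m
  zero_mem' := ⟨0, MvPolynomial.isHomogeneous_zero _ _ _, by simp [laplacian], by ext; simp⟩
  add_mem' := by
    rintro _ _ ⟨P, hP, hP0, rfl⟩ ⟨Q, hQ, hQ0, rfl⟩
    refine ⟨P + Q, hP.add hQ, ?_, by ext; simp⟩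
    rw [laplacian] at *
    simp [Finset.sum_add_distrib, hP0, hQ0]
  smul_mem' := by
    rintro c _ ⟨P, hP, hP0, rfl⟩
    refine ⟨c • P, (MvPolynomial.homogeneousSubmodule _ _ m).smul_mem c hP, ?_,
      by ext; simp [MvPolynomial.smul_eval]⟩
    rw [laplacian] at *
    simp [← Finset.smul_sum, hP0]

instance (d m : ℕ) : FiniteDimensional ℝ (harmonicSubmodule d m) := by
  have : Module.Finite ℝ (MvPolynomial.homogeneousSubmodule (Fin d) ℝ m) :=
    Module.Finite.iff_fg.mpr (MvPolynomial.homogeneousSubmodule_fg (Fin d) ℝ m)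
  let φ : MvPolynomial (Fin d) ℝ →ₗ[ℝ] (E d → ℝ) :=
    { toFun := polyFun
      map_add' := fun P Q => by ext; simp [polyFun]
      map_smul' := fun c P => by ext; simp [polyFun, MvPolynomial.smul_eval] }
  refine Submodule.finiteDimensional_of_le
    (S₂ := (MvPolynomial.homogeneousSubmodule (Fin d) ℝ m).map φ) ?_
  rintro _ ⟨P, hP, -, rfl⟩
  exact ⟨P, hP, rfl⟩

/-- Sums of solid harmonics of degrees less than `N`. -/
def harmonicLT (d : ℕ) : ℕ → Submodule ℝ (E d → ℝ)
  | 0 => ⊥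
  | N + 1 => harmonicLT d N ⊔ harmonicSubmodule d N

lemma harmonicLT_mono {d : ℕ} : Monotone (harmonicLT d) :=
  monotone_nat_of_le_succ fun _ => le_sup_left

lemma harmonicSubmodule_le {d m N : ℕ} (h : m < N) : harmonicSubmodule d m ≤ harmonicLT d N :=
  le_trans (b := harmonicLT d (m + 1)) le_sup_right (harmonicLT_mono h)

lemma contDiff_of_mem_harmonicSubmodule {d m : ℕ} {Y : E d → ℝ} (hY : Y ∈ harmonicSubmodule d m)
    {k : WithTop ℕ∞} : ContDiff ℝ k Y := by
  obtain ⟨P, -, -, rfl⟩ := hY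
  exact contDiff_polyFun P

lemma harmonicSubmodule_smul {d m : ℕ} {Y : E d → ℝ} (hY : Y ∈ harmonicSubmodule d m)
    (r : ℝ) (x : E d) : Y (r • x) = r ^ m * Y x := by
  obtain ⟨P, hP, -, rfl⟩ := hY
  exact polyFun_smul hP r x

lemma harmonicLT_induction {d N : ℕ} {p : (E d → ℝ) → Prop} (h0 : p 0)
    (hadd : ∀ f g, p f → p g → p (f + g))
    (hH : ∀ m < N, ∀ Y ∈ harmonicSubmodule d m, p Y) {Z : E d → ℝ} (hZ : Z ∈ harmonicLT d N) :
    p Z := by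
  induction N generalizing Z with
  | zero =>
    have : Z = 0 := hZ
    rwa [this]
  | succ N ih =>
    obtain ⟨Z', hZ', Y, hY, rfl⟩ := Submodule.mem_sup.mp hZ
    exact hadd _ _ (ih (fun m hm => hH m (by omega)) hZ') (hH N (by omega) Y hY)

lemma continuous_of_mem_harmonicLT {d N : ℕ} {Z : E d → ℝ} (hZ : Z ∈ harmonicLT d N) :
    Continuous Z :=
  harmonicLT_induction continuous_const (fun _ _ hf hg => hf.add hg)
    (fun _ _ _ hY => (contDiff_of_mem_harmonicSubmodule (k := 0) hY).continuous) hZ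

lemma dilation_mem_harmonicLT {d N : ℕ} (r : ℝ) {Z : E d → ℝ} (hZ : Z ∈ harmonicLT d N) :
    (fun x => Z (r • x)) ∈ harmonicLT d N := by
  refine harmonicLT_induction (p := fun Z => (fun x => Z (r • x)) ∈ harmonicLT d N)
    (Submodule.zero_mem _) (fun f g hf hg => Submodule.add_mem _ hf hg) (fun m hm Y hY => ?_) hZ
  have : (fun x => Y (r • x)) = r ^ m • Y := by
    ext x; simp [harmonicSubmodule_smul hY]
  rw [this]
  exact harmonicSubmodule_le hm (Submodule.smul_mem _ _ hY)

/-! ### The inner product on the sphere -/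

/-- Functions whose restriction to the unit sphere is continuous. -/
def sphContinuous (d : ℕ) : Submodule ℝ (E d → ℝ) where
  carrier := {g | ContinuousOn g (Metric.sphere 0 1)}
  zero_mem' := continuousOn_const
  add_mem' := fun hf hg => ContinuousOn.add hf hg
  smul_mem' := fun c _ hf => ContinuousOn.const_smul hf c

instance (d : ℕ) : IsFiniteMeasure (sphMeasure d) := by unfold sphMeasure; infer_instance

instance (d : ℕ) : (sphMeasure d).IsOpenPosMeasure := by unfold sphMeasure; infer_instance

lemma sphArea_pos {d : ℕ} (hd : 2 ≤ d) : 0 < sphArea d := by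
  have : Nonempty (Fin d) := ⟨⟨0, by omega⟩⟩
  rw [sphArea, sphMeasure, Measure.toSphere_real_apply_univ]
  have h1 : 0 < (volume : Measure (E d)).real (Metric.ball 0 1) :=
    ENNReal.toReal_pos (Metric.measure_ball_pos _ _ one_pos).ne' measure_ball_lt_top.ne
  have h2 : 0 < Module.finrank ℝ (E d) := Module.finrank_pos
  positivity

lemma integrable_sphMeasure {d : ℕ} {g : E d → ℝ} (hg : ContinuousOn g (Metric.sphere 0 1)) :
    Integrable (fun ξ : Metric.sphere (0 : E d) 1 => g ξ) (sphMeasure d) :=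
  (continuousOn_iff_continuous_domRestrict.mp hg).integrable_of_hasCompactSupport
    (HasCompactSupport.of_compactSpace _)

lemma sphInt_congr {d : ℕ} {g h : E d → ℝ} (hgh : Set.EqOn g h (Metric.sphere 0 1)) :
    sphInt d g = sphInt d h :=
  integral_congr_ae (Filter.Eventually.of_forall fun ξ => hgh ξ.2)

lemma sphInner_congr {d : ℕ} {f f' g g' : E d → ℝ} (hf : Set.EqOn f f' (Metric.sphere 0 1))
    (hg : Set.EqOn g g' (Metric.sphere 0 1)) : sphInner d f g = sphInner d f' g' := by
  rw [sphInner, sphInner, sphInt_congr fun ξ hξ => by rw [hf hξ, hg hξ]]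

lemma sphInt_add {d : ℕ} {f g : E d → ℝ} (hf : ContinuousOn f (Metric.sphere 0 1))
    (hg : ContinuousOn g (Metric.sphere 0 1)) :
    sphInt d (fun ξ => f ξ + g ξ) = sphInt d f + sphInt d g :=
  integral_add (integrable_sphMeasure hf) (integrable_sphMeasure hg)

lemma sphInt_const_mul {d : ℕ} (c : ℝ) (f : E d → ℝ) :
    sphInt d (fun ξ => c * f ξ) = c * sphInt d f :=
  integral_const_mul c _

lemma isForm_sphInner (d : ℕ) : IsForm (sphInner d) (sphContinuous d) where
  symm f g := by simp only [sphInner, mul_comm]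
  add_left f hf g hg h hh := by
    simp only [sphInner, Pi.add_apply, add_mul]
    rw [sphInt_add (f := fun ξ => f ξ * h ξ) (g := fun ξ => g ξ * h ξ) (ContinuousOn.mul hf hh)
      (ContinuousOn.mul hg hh), mul_add]
  smul_left c f hf h hh := by
    simp only [sphInner, Pi.smul_apply, smul_eq_mul, mul_assoc c]
    rw [sphInt_const_mul, mul_left_comm]

lemma sphInner_self_nonneg {d : ℕ} (f : E d → ℝ) : 0 ≤ sphInner d f f := by
  unfold sphInner sphInt sphArea
  exact mul_nonneg (by positivity) (integral_nonneg fun ξ => mul_self_nonneg _)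

lemma eqOn_zero_of_sphInt_eq_zero {d : ℕ} {g : E d → ℝ}
    (hg : ContinuousOn g (Metric.sphere 0 1)) (h0 : ∀ ξ ∈ Metric.sphere (0 : E d) 1, 0 ≤ g ξ)
    (h : sphInt d g = 0) : ∀ ξ ∈ Metric.sphere (0 : E d) 1, g ξ = 0 := by
  have h1 := (integral_eq_zero_iff_of_nonneg (fun ξ => h0 _ ξ.2) (integrable_sphMeasure hg)).mp h
  have h2 := (continuousOn_iff_continuous_domRestrict.mp hg).ae_eq_iff_eq (sphMeasure d)
    continuous_const |>.mp h1
  intro ξ hξ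
  exact congr_fun h2 ⟨ξ, hξ⟩

lemma eqOn_zero_of_sphInner_self {d : ℕ} (hd : 2 ≤ d) {f : E d → ℝ} (hf : f ∈ sphContinuous d)
    (h : sphInner d f f = 0) : ∀ ξ ∈ Metric.sphere (0 : E d) 1, f ξ = 0 := by
  have h1 : sphInt d (fun ξ => f ξ * f ξ) = 0 :=
    (mul_eq_zero.mp h).resolve_left (one_div_ne_zero (sphArea_pos hd).ne')
  intro ξ hξ
  exact mul_self_eq_zero.mp
    (eqOn_zero_of_sphInt_eq_zero (ContinuousOn.mul hf hf) (fun ξ _ => mul_self_nonneg _) h1 ξ hξ)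

lemma harmonicLT_le_sphContinuous (d N : ℕ) : harmonicLT d N ≤ sphContinuous d :=
  fun _ hZ => (continuous_of_mem_harmonicLT hZ).continuousOn

lemma harmonicSubmodule_le_sphContinuous (d m : ℕ) : harmonicSubmodule d m ≤ sphContinuous d :=
  (harmonicSubmodule_le (Nat.lt_succ_self m)).trans (harmonicLT_le_sphContinuous d (m + 1))

lemma sphInner_orthogonal {d m l : ℕ} (hd : 2 ≤ d) (hml : m ≠ l) {Y Z : E d → ℝ}
    (hY : Y ∈ harmonicSubmodule d m) (hZ : Z ∈ harmonicSubmodule d l) : sphInner d Y Z = 0 := by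
  obtain ⟨P, hP, hP0, rfl⟩ := hY
  obtain ⟨Q, hQ, hQ0, rfl⟩ := hZ
  have := sphInt_polyFun_orthogonal hd hml hP hP0 hQ hQ0
  rw [sphInner]
  refine mul_eq_zero_of_right _ ?_
  rw [← this]
  congr 1 with x
  simp [polyFun]

lemma sphInner_harmonicLT_orthogonal {d N m : ℕ} (hd : 2 ≤ d) (hm : N ≤ m) {Y Z : E d → ℝ}
    (hZ : Z ∈ harmonicLT d N) (hY : Y ∈ harmonicSubmodule d m) : sphInner d Z Y = 0 := by
  have hYc := harmonicSubmodule_le_sphContinuous d m hY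
  refine (harmonicLT_induction (p := fun Z => Z ∈ sphContinuous d ∧ sphInner d Z Y = 0)
    ⟨Submodule.zero_mem _, (isForm_sphInner d).zero_left hYc⟩ (fun f g hf hg => ?_)
    (fun l hl Y' hY' => ?_) hZ).2
  · refine ⟨Submodule.add_mem _ hf.1 hg.1, ?_⟩
    rw [(isForm_sphInner d).add_left _ hf.1 _ hg.1 _ hYc, hf.2, hg.2, add_zero]
  · exact ⟨harmonicSubmodule_le_sphContinuous d l hY',
      sphInner_orthogonal hd (by omega) hY' hY⟩

lemma exists_eq_smul_sphere {d : ℕ} (hd : 2 ≤ d) (x : E d) :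
    ∃ ξ ∈ Metric.sphere (0 : E d) 1, x = ‖x‖ • ξ := by
  have : Nonempty (Fin d) := ⟨⟨0, by omega⟩⟩
  by_cases hx : x = 0
  · obtain ⟨ξ, hξ⟩ := (NormedSpace.sphere_nonempty (x := (0 : E d)) (r := 1)).mpr zero_le_one
    exact ⟨ξ, hξ, by simp [hx]⟩
  · refine ⟨‖x‖⁻¹ • x, ?_, ?_⟩
    · simp [norm_smul, norm_ne_zero_iff.mpr hx]
    · rw [smul_smul, mul_inv_cancel₀ (norm_ne_zero_iff.mpr hx), one_smul]

lemma harmonic_eq_zero {d m : ℕ} (hd : 2 ≤ d) {Y : E d → ℝ} (hY : Y ∈ harmonicSubmodule d m)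
    (h : ∀ ξ ∈ Metric.sphere (0 : E d) 1, Y ξ = 0) : Y = 0 := by
  ext x
  obtain ⟨ξ, hξ, hx⟩ := exists_eq_smul_sphere hd x
  rw [hx, harmonicSubmodule_smul hY, h ξ hξ, mul_zero, Pi.zero_apply]

/-- A sum of solid harmonics is determined by its values on the sphere. -/
lemma harmonicLT_eq_zero {d N : ℕ} (hd : 2 ≤ d) {Z : E d → ℝ} (hZ : Z ∈ harmonicLT d N)
    (h : ∀ ξ ∈ Metric.sphere (0 : E d) 1, Z ξ = 0) : Z = 0 := by
  induction N generalizing Z with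
  | zero => exact hZ
  | succ N ih =>
    obtain ⟨Z', hZ', Y, hY, rfl⟩ := Submodule.mem_sup.mp hZ
    have hYc := harmonicSubmodule_le_sphContinuous d N hY
    -- Pairing with the top-degree component Y removes the lower degrees and leaves ⟨Y, Y⟩.
    have h1 : sphInner d (Z' + Y) Y = 0 := by
      rw [sphInner_congr (f' := 0) (g' := Y) h fun _ _ => rfl]
      exact (isForm_sphInner d).zero_left hYc
    rw [(isForm_sphInner d).add_left _ (harmonicLT_le_sphContinuous d N hZ') _ hYc _ hYc,
      sphInner_harmonicLT_orthogonal hd le_rfl hZ' hY, zero_add] at h1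
    have hY0 : Y = 0 := harmonic_eq_zero hd hY (eqOn_zero_of_sphInner_self hd hYc h1)
    subst hY0
    rw [add_zero] at h ⊢
    exact ih hZ' h

lemma harmonicLT_definite {d N : ℕ} (hd : 2 ≤ d) {Z : E d → ℝ} (hZ : Z ∈ harmonicLT d N)
    (h : sphInner d Z Z = 0) : Z = 0 :=
  harmonicLT_eq_zero hd hZ
    (eqOn_zero_of_sphInner_self hd (harmonicLT_le_sphContinuous d N hZ) h)

/-- Testing against the part of Z of degree below N shows that this part has norm zero. -/
lemma mem_harmonicSubmodule_of_orthogonal {d N : ℕ} (hd : 2 ≤ d) {Z : E d → ℝ}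
    (hZ : Z ∈ harmonicLT d (N + 1)) (h : ∀ Y ∈ harmonicLT d N, sphInner d Z Y = 0) :
    Z ∈ harmonicSubmodule d N := by
  obtain ⟨Z', hZ', Y, hY, rfl⟩ := Submodule.mem_sup.mp hZ
  have h1 := h Z' hZ'
  have hZc := harmonicLT_le_sphContinuous d N hZ'
  rw [(isForm_sphInner d).add_left _ hZc _ (harmonicSubmodule_le_sphContinuous d N hY) _ hZc,
    (isForm_sphInner d).symm Y, sphInner_harmonicLT_orthogonal hd le_rfl hZ' hY, add_zero] at h1
  rw [harmonicLT_definite hd hZ' h1, zero_add]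
  exact hY

lemma sphProj_spec {d : ℕ} (hd : 2 ≤ d) (m : ℕ) {g : E d → ℝ} (hg : g ∈ sphContinuous d) :
    sphProj d m g ∈ harmonicSubmodule d m ∧
      ∀ Y ∈ harmonicSubmodule d m, sphInner d (g - sphProj d m g) Y = 0 :=
  (isForm_sphInner d).orthProj_spec (harmonicSubmodule_le_sphContinuous d m)
    (fun _ hY h => harmonicLT_definite hd (harmonicSubmodule_le (Nat.lt_succ_self m) hY) h) hg

/-! ### Derivatives in the last variable -/

section tderiv

variable {d : ℕ} {f g : E d × ℝ → ℝ} {p : E d × ℝ}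

lemma tderiv_zero (f : E d × ℝ → ℝ) : tderiv 0 f = f := by
  ext p; simp [tderiv]

lemma tderiv_one (f : E d × ℝ → ℝ) (p : E d × ℝ) :
    tderiv 1 f p = deriv (fun τ => f (p.1, τ)) p.2 := by
  simp [tderiv, iteratedDeriv_one]

lemma tderiv_succ (k : ℕ) (f : E d × ℝ → ℝ) : tderiv (k + 1) f = tderiv 1 (tderiv k f) := by
  ext p
  rw [tderiv_one, tderiv, iteratedDeriv_succ]
  rfl

lemma contDiffAt_slice {n : WithTop ℕ∞} (hf : ContDiffAt ℝ n f p) :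
    ContDiffAt ℝ n (fun τ => f (p.1, τ)) p.2 :=
  ContDiffAt.comp (x := p.2) (f := fun τ : ℝ => (p.1, τ)) (g := f) hf
    (contDiffAt_const.prodMk contDiffAt_id)

lemma tderiv_add {k : ℕ} (hf : ContDiffAt ℝ k f p) (hg : ContDiffAt ℝ k g p) :
    tderiv k (f + g) p = tderiv k f p + tderiv k g p :=
  iteratedDeriv_add (contDiffAt_slice hf) (contDiffAt_slice hg)

lemma tderiv_smul {k : ℕ} (c : ℝ) (f : E d × ℝ → ℝ) :
    tderiv k (c • f) p = c * tderiv k f p :=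
  iteratedDeriv_const_mul_field c _

/-- Near p, `∂_t f` is the Fréchet derivative applied to (0, 1); this gives regularity jointly in
(x, t), not only along vertical lines. -/
lemma contDiffAt_tderiv_one {j : ℕ} (hf : ContDiffAt ℝ (j + 1 : ℕ) f p) :
    ContDiffAt ℝ j (tderiv 1 f) p := by
  have h1 : ContDiffAt ℝ j (fun q => fderiv ℝ f q (0, 1)) p :=
    (hf.fderiv_right (m := j) (by norm_cast)).clm_apply contDiffAt_const
  refine h1.congr_of_eventuallyEq ?_
  filter_upwards [hf.eventually (by simp)] with q hq
  rw [tderiv_one]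
  have h2 : HasFDerivAt f (fderiv ℝ f q) (q.1, q.2) :=
    (hq.differentiableAt (by simp)).hasFDerivAt
  have h3 : HasDerivAt (fun τ : ℝ => (q.1, τ)) ((0 : E d), (1 : ℝ)) q.2 :=
    (hasDerivAt_const _ _).prodMk (hasDerivAt_id _)
  exact (h2.comp_hasDerivAt q.2 h3).deriv

lemma contDiffAt_tderiv {j k : ℕ} (hf : ContDiffAt ℝ (j + k : ℕ) f p) :
    ContDiffAt ℝ j (tderiv k f) p := by
  induction k generalizing j with
  | zero => simpa [tderiv_zero] using hf
  | succ k ih =>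
    rw [tderiv_succ]
    exact contDiffAt_tderiv_one (ih (by rwa [add_assoc, add_comm 1]))

lemma continuousAt_tderiv {k s : ℕ} (hk : k ≤ s) (hf : ContDiffAt ℝ s f p) :
    ContinuousAt (tderiv k f) p :=
  (contDiffAt_tderiv (j := 0) (hf.of_le (by simpa using hk))).continuousAt

/-- Taylor's formula at the base of the cone. -/
lemma taylor_base {s : ℕ} (hs : 1 ≤ s) (x : E d) (t : ℝ)
    (hf : ∀ v ∈ Set.uIcc 1 t, ContDiffAt ℝ s f (x, v)) :
    f (x, t) = (∑ m ∈ Finset.range s, (t - 1) ^ m / (Nat.factorial m : ℝ) * tderiv m f (x, 1)) +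
      (-1 : ℝ) ^ s * ∫ v in t..1, (v - t) ^ (s - 1) / (Nat.factorial (s - 1) : ℝ) *
        tderiv s f (x, v) := by
  obtain ⟨n, rfl⟩ : ∃ n, s = n + 1 := ⟨s - 1, by omega⟩
  simp only [Nat.add_sub_cancel]
  have hf' : ∀ v ∈ Set.uIcc 1 t, ContDiffAt ℝ (n + 1 : ℕ) (fun τ => f (x, τ)) v :=
    fun v hv => contDiffAt_slice (hf v hv)
  -- For t = 1 the interval degenerates, and derivatives within it are not unique; only the term m =
  -- 0 survives.
  rcases eq_or_ne 1 t with rfl | ht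
  · simp [Finset.sum_range_succ', tderiv_zero]
  have hu : UniqueDiffOn ℝ (Set.uIcc 1 t) := uniqueDiffOn_uIcc ht
  have key := taylor_integral_remainder (f := fun τ => f (x, τ)) (x := t) (x₀ := 1) (n := n)
    (fun v hv => (hf' v hv).contDiffWithinAt)
  have h1 : ∀ m ≤ n + 1, ∀ v ∈ Set.uIcc 1 t,
      iteratedDerivWithin m (fun τ => f (x, τ)) (Set.uIcc 1 t) v = tderiv m f (x, v) := by
    intro m hm v hv
    exact iteratedDerivWithin_eq_iteratedDeriv hu ((hf' v hv).of_le (by exact_mod_cast hm)) hv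
  rw [taylor_within_apply, sub_eq_iff_eq_add'] at key
  rw [key]
  congr 1
  · refine Finset.sum_congr rfl fun m hm => ?_
    rw [h1 m (by simp at hm; omega) 1 Set.left_mem_uIcc, smul_eq_mul]
    ring
  -- Reversing the limits gives one sign and (t - v)^n = (-1)^n (v - t)^n the others, in total
  -- (-1)^(n+1).
  · rw [intervalIntegral.integral_symm, ← intervalIntegral.integral_const_mul,
      ← intervalIntegral.integral_neg]
    refine intervalIntegral.integral_congr fun v hv => ?_
    rw [h1 (n + 1) le_rfl v (by rwa [Set.uIcc_comm]), smul_eq_mul,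
      show t - v = -1 * (v - t) by ring, mul_pow, pow_succ (-1 : ℝ) n]
    ring

end tderiv

/-! ### Polynomials on the cone -/

section conePoly

variable {d N : ℕ} {g : E d × ℝ → ℝ}

lemma monomial_mem_conePoly {j m : ℕ} (h : j + m < N) {Y : E d → ℝ}
    (hY : Y ∈ harmonicSubmodule d m) : (fun p : E d × ℝ => p.2 ^ j * Y p.1) ∈ conePoly d N :=
  Submodule.subset_span ⟨j, m, Y, h, hY, rfl⟩

lemma conePoly_induction {P : (E d × ℝ → ℝ) → Prop} (h0 : P 0)
    (hadd : ∀ f ∈ conePoly d N, ∀ g ∈ conePoly d N, P f → P g → P (f + g))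
    (hsmul : ∀ (c : ℝ), ∀ f ∈ conePoly d N, P f → P (c • f))
    (hmon : ∀ j m, j + m < N → ∀ Y ∈ harmonicSubmodule d m, P (fun p => p.2 ^ j * Y p.1))
    (hg : g ∈ conePoly d N) : P g := by
  refine Submodule.span_induction (p := fun g _ => P g) ?_ h0 (fun f g hf hg => hadd f hf g hg)
    (fun c f hf => hsmul c f hf) hg
  rintro _ ⟨j, m, Y, h, hY, rfl⟩
  exact hmon j m h Y hY

lemma conePoly_mono {M N : ℕ} (h : M ≤ N) : conePoly d M ≤ conePoly d N := by
  refine Submodule.span_mono ?_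
  rintro _ ⟨j, m, Y, hjm, hY, rfl⟩
  exact ⟨j, m, Y, by omega, hY, rfl⟩

lemma conePoly_zero_eq_bot : conePoly d 0 = ⊥ := by
  rw [conePoly, Submodule.span_eq_bot]
  rintro _ ⟨j, m, Y, h, -⟩
  omega

lemma contDiff_of_mem_conePoly (hg : g ∈ conePoly d N) {n : WithTop ℕ∞} : ContDiff ℝ n g := by
  refine conePoly_induction (P := fun g => ContDiff ℝ n g) contDiff_const
    (fun _ _ _ _ hf hg => hf.add hg) (fun c _ _ hf => contDiff_const.smul hf)
    (fun j m _ Y hY => ?_) hg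
  exact (contDiff_snd.pow j).mul ((contDiff_of_mem_harmonicSubmodule hY).comp contDiff_fst)

lemma slice_mem_harmonicLT (hg : g ∈ conePoly d N) (t : ℝ) :
    (fun x => g (x, t)) ∈ harmonicLT d N := by
  refine conePoly_induction (P := fun g => (fun x => g (x, t)) ∈ harmonicLT d N)
    (Submodule.zero_mem _) (fun _ _ _ _ hf hg => Submodule.add_mem _ hf hg)
    (fun c _ _ hf => Submodule.smul_mem _ c hf)
    (fun j m h Y hY => harmonicSubmodule_le (by omega) (Submodule.smul_mem _ (t ^ j) hY)) hg

lemma slice_eq_polynomial (hg : g ∈ conePoly d N) (x : E d) :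
    ∃ P : Polynomial ℝ, ∀ t, g (x, t) = P.eval t := by
  refine conePoly_induction (P := fun g => ∃ P : Polynomial ℝ, ∀ t, g (x, t) = P.eval t)
    ⟨0, by simp⟩ ?_ ?_ (fun j m _ Y _ => ⟨Polynomial.X ^ j * Polynomial.C (Y x), by
      simp only [Polynomial.eval_mul, Polynomial.eval_pow, Polynomial.eval_X, Polynomial.eval_C,
        implies_true]⟩) hg
  · rintro _ - _ - ⟨P, hP⟩ ⟨Q, hQ⟩
    exact ⟨P + Q, by simp [hP, hQ]⟩
  · rintro c _ - ⟨P, hP⟩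
    exact ⟨c • P, by simp [hP]⟩

/-- A polynomial that vanishes on the conic surface vanishes. -/
lemma conePoly_eq_zero (hd : 2 ≤ d) (hg : g ∈ conePoly d N)
    (h : ∀ t ∈ Set.Ioo (0 : ℝ) 1, ∀ ξ ∈ Metric.sphere (0 : E d) 1, g (t • ξ, t) = 0) : g = 0 := by
  have h1 : ∀ t ∈ Set.Ioo (0 : ℝ) 1, ∀ x, g (x, t) = 0 := by
    intro t ht x
    -- The slice at height t vanishes on the sphere of radius t. Dilation by t moves this to the
    -- unit sphere, and the point t⁻¹x undoes the dilation.
    have := congr_fun (harmonicLT_eq_zero hd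
      (dilation_mem_harmonicLT t (slice_mem_harmonicLT hg t)) (h t ht)) (t⁻¹ • x)
    simpa [smul_smul, ht.1.ne'] using this
  ext ⟨x, t⟩
  obtain ⟨P, hP⟩ := slice_eq_polynomial hg x
  have hP0 : P = 0 := by
    refine P.eq_zero_of_infinite_isRoot ((Set.Ioo_infinite one_pos).mono fun t ht => ?_)
    exact (hP t).symm.trans (h1 t ht x)
  simp [hP, hP0]

instance : FiniteDimensional ℝ (conePoly d N) := by
  let φ (j : ℕ) : (E d → ℝ) →ₗ[ℝ] (E d × ℝ → ℝ) :=
    { toFun := fun Y p => p.2 ^ j * Y p.1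
      map_add' := fun Y Z => by ext; simp [mul_add]
      map_smul' := fun c Y => by ext; simp [mul_left_comm] }
  refine Submodule.finiteDimensional_of_le
    (S₂ := ⨆ i : Fin N × Fin N, (harmonicSubmodule d i.2).map (φ i.1)) ?_
  refine Submodule.span_le.mpr ?_
  rintro _ ⟨j, m, Y, h, hY, rfl⟩
  exact Submodule.mem_iSup_of_mem (⟨j, by omega⟩, ⟨m, by omega⟩) ⟨Y, hY, rfl⟩

lemma tderiv_add_of_mem {M k : ℕ} {f : E d × ℝ → ℝ} (hf : f ∈ conePoly d M)
    (hg : g ∈ conePoly d N) : tderiv k (f + g) = tderiv k f + tderiv k g := by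
  ext p
  exact tderiv_add (contDiff_of_mem_conePoly hf).contDiffAt
    (contDiff_of_mem_conePoly hg).contDiffAt

lemma tderiv_zero_fun (k : ℕ) : tderiv k (0 : E d × ℝ → ℝ) = 0 := by
  ext p
  simpa using tderiv_smul (p := p) (k := k) 0 0

lemma tderiv_one_mem_conePoly (hg : g ∈ conePoly d N) : tderiv 1 g ∈ conePoly d (N - 1) := by
  refine conePoly_induction (P := fun g => tderiv 1 g ∈ conePoly d (N - 1)) ?_ ?_ ?_ ?_ hg
  · rw [tderiv_zero_fun]; exact Submodule.zero_mem _
  · intro f hf g hg h1 h2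
    rw [tderiv_add_of_mem hf hg]
    exact Submodule.add_mem _ h1 h2
  · intro c f _ hf
    have : tderiv 1 (c • f) = c • tderiv 1 f := funext fun p => tderiv_smul c f
    rw [this]
    exact Submodule.smul_mem _ c hf
  · intro j m h Y hY
    have : tderiv 1 (fun p : E d × ℝ => p.2 ^ j * Y p.1) =
        fun p => p.2 ^ (j - 1) * ((j : ℝ) • Y) p.1 := by
      ext p
      rw [tderiv_one]
      simp
      ring
    rw [this]
    -- For j = 0 the truncated exponent j - 1 would break the degree bound, but the coefficient j is
    -- then zero.
    rcases Nat.eq_zero_or_pos j with rfl | hj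
    · have h0 : (fun p : E d × ℝ => p.2 ^ (0 - 1) * (((0 : ℕ) : ℝ) • Y) p.1) = 0 := by
        ext; simp
      rw [h0]
      exact Submodule.zero_mem _
    · exact monomial_mem_conePoly (by omega) (Submodule.smul_mem _ _ hY)

lemma tderiv_mem_conePoly (k : ℕ) (hg : g ∈ conePoly d N) : tderiv k g ∈ conePoly d (N - k) := by
  induction k with
  | zero => simpa [tderiv_zero] using hg
  | succ k ih =>
    rw [tderiv_succ, ← Nat.sub_sub]
    exact tderiv_one_mem_conePoly ih

lemma harmonicLT_mem_conePoly {Z : E d → ℝ} (hZ : Z ∈ harmonicLT d N) :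
    (fun p : E d × ℝ => Z p.1) ∈ conePoly d N := by
  refine harmonicLT_induction (p := fun Z => (fun p : E d × ℝ => Z p.1) ∈ conePoly d N)
    (Submodule.zero_mem _) (fun _ _ hf hg => Submodule.add_mem _ hf hg) (fun m hm Y hY => ?_) hZ
  simpa using monomial_mem_conePoly (j := 0) (N := N) (by omega) hY

lemma tderiv_one_of_harmonic (Z : E d → ℝ) : tderiv 1 (fun p : E d × ℝ => Z p.1) = 0 := by
  ext p
  rw [tderiv_one]
  simp

lemma exists_antiderivative (hg : g ∈ conePoly d N) :
    ∃ G ∈ conePoly d (N + 1), tderiv 1 G = g := by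
  refine conePoly_induction (P := fun g => ∃ G ∈ conePoly d (N + 1), tderiv 1 G = g) ?_ ?_ ?_ ?_ hg
  · exact ⟨0, Submodule.zero_mem _, tderiv_zero_fun 1⟩
  · rintro _ - _ - ⟨F, hF, rfl⟩ ⟨G, hG, rfl⟩
    exact ⟨F + G, Submodule.add_mem _ hF hG, tderiv_add_of_mem hF hG⟩
  · rintro c _ - ⟨F, hF, rfl⟩
    exact ⟨c • F, Submodule.smul_mem _ c hF, funext fun p => tderiv_smul c F⟩
  · intro j m h Y hY
    refine ⟨fun p => p.2 ^ (j + 1) * (((j : ℝ) + 1)⁻¹ • Y) p.1,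
      monomial_mem_conePoly (by omega) (Submodule.smul_mem _ _ hY), ?_⟩
    ext p
    rw [tderiv_one]
    have : (j : ℝ) + 1 ≠ 0 := by positivity
    simp
    field_simp

/-- Polynomials are determined by a derivative and the lower derivatives at the base of the cone,
which can be prescribed. -/
lemma exists_conePoly_data (s : ℕ) {p : E d × ℝ → ℝ} (hp : p ∈ conePoly d (N - s))
    (Z : ℕ → E d → ℝ) (hZ : ∀ m < s, Z m ∈ harmonicLT d (N - m)) :
    ∃ P ∈ conePoly d N, tderiv s P = p ∧ ∀ m < s, ∀ x, tderiv m P (x, 1) = Z m x := by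
  induction s generalizing p with
  | zero => exact ⟨p, hp, tderiv_zero p, by simp⟩
  | succ s ih =>
    -- G is to be the s-th derivative of P: an antiderivative of p, corrected by a function of x
    -- alone so that its trace at t = 1 is Z s. If N ≤ s, all these spaces are zero.
    obtain ⟨G, hG, hG1, hG2⟩ : ∃ G ∈ conePoly d (N - s), tderiv 1 G = p ∧
        ∀ x, G (x, 1) = Z s x := by
      rcases Nat.lt_or_ge s N with hs | hs
      · obtain ⟨F, hF, hF1⟩ := exists_antiderivative hp
        rw [show N - (s + 1) + 1 = N - s by omega] at hF
        have h2 := harmonicLT_mem_conePoly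
          (Submodule.sub_mem _ (hZ s (by omega)) (slice_mem_harmonicLT hF 1))
        refine ⟨_, Submodule.add_mem _ hF h2, ?_, ?_⟩
        · rw [tderiv_add_of_mem hF h2, tderiv_one_of_harmonic, hF1, add_zero]
        · simp
      · have hZ0 := hZ s (by omega)
        rw [show N - (s + 1) = 0 by omega, conePoly_zero_eq_bot, Submodule.mem_bot] at hp
        rw [show N - s = 0 by omega] at hZ0
        have hZ0 : Z s = 0 := hZ0
        exact ⟨0, Submodule.zero_mem _, by rw [hp, tderiv_zero_fun], by simp [hZ0]⟩
    obtain ⟨P, hP, hP1, hP2⟩ := ih hG fun m hm => hZ m (by omega)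
    refine ⟨P, hP, by rw [tderiv_succ, hP1, hG1], fun m hm x => ?_⟩
    rcases Nat.lt_succ_iff_lt_or_eq.mp hm with hm | rfl
    · exact hP2 m hm x
    · rw [hP1, hG2]

lemma taylor_base_conePoly {s : ℕ} (hs : 1 ≤ s) (hg : g ∈ conePoly d N) (x : E d) (t : ℝ) :
    g (x, t) = (∑ m ∈ Finset.range s, (t - 1) ^ m / (Nat.factorial m : ℝ) * tderiv m g (x, 1)) +
      (-1 : ℝ) ^ s * ∫ v in t..1, (v - t) ^ (s - 1) / (Nat.factorial (s - 1) : ℝ) *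
        tderiv s g (x, v) :=
  taylor_base hs x t fun _ _ => (contDiff_of_mem_conePoly hg).contDiffAt

end conePoly

/-! ### The inner product on the conic surface -/

/-- Functions whose restriction to the conic surface is continuous. -/
def coneContinuous (d : ℕ) : Submodule ℝ (E d × ℝ → ℝ) where
  carrier := {g | ContinuousOn g (cone d)}
  zero_mem' := continuousOn_const
  add_mem' := fun hf hg => ContinuousOn.add hf hg
  smul_mem' := fun c _ hf => ContinuousOn.const_smul hf c

lemma smul_sphere_mem_cone {d : ℕ} {t : ℝ} (ht : t ∈ Set.Icc (0 : ℝ) 1) {ξ : E d}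
    (hξ : ξ ∈ Metric.sphere (0 : E d) 1) : (t • ξ, t) ∈ cone d := by
  refine ⟨?_, ht.1, ht.2⟩
  have : ‖ξ‖ = 1 := by simpa using hξ
  simp [norm_smul, this, abs_of_nonneg ht.1]

lemma sphere_mem_cone {d : ℕ} {ξ : E d} (hξ : ξ ∈ Metric.sphere (0 : E d) 1) :
    (ξ, (1 : ℝ)) ∈ cone d := by
  simpa using smul_sphere_mem_cone (t := 1) (by simp) hξ

lemma continuousOn_smul_sphere {d : ℕ} {g : E d × ℝ → ℝ} (hg : ContinuousOn g (cone d)) {t : ℝ}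
    (ht : t ∈ Set.Icc (0 : ℝ) 1) : ContinuousOn (fun ξ => g (t • ξ, t)) (Metric.sphere 0 1) :=
  hg.comp (by fun_prop) fun _ hξ => smul_sphere_mem_cone ht hξ

/-- The integrals over the slices of the conic surface depend continuously on the height. -/
lemma continuousOn_slice_sphInt {d : ℕ} {g : E d × ℝ → ℝ} (hg : ContinuousOn g (cone d)) :
    ContinuousOn (fun t => sphInt d fun ξ => g (t • ξ, t)) (Set.Icc 0 1) := by
  rw [continuousOn_iff_continuous_domRestrict]
  have h : Continuous (Function.uncurry fun (t : Set.Icc (0 : ℝ) 1)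
      (ξ : Metric.sphere (0 : E d) 1) => g ((t : ℝ) • (ξ : E d), (t : ℝ))) :=
    hg.comp_continuous (f := fun p : Set.Icc (0 : ℝ) 1 × Metric.sphere (0 : E d) 1 =>
      ((p.1 : ℝ) • (p.2 : E d), (p.1 : ℝ))) (by fun_prop)
      fun p => smul_sphere_mem_cone p.1.2 p.2.2
  have := continuous_parametric_integral_of_continuous (μ := sphMeasure d) h isCompact_univ
  simp only [Measure.restrict_univ] at this
  exact this

/-- The radial part of the weight on the conic surface. -/
lemma intervalIntegrable_weight {d : ℕ} {a : ℝ} (ha : -(d : ℝ) < a) (hd : 2 ≤ d) :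
    IntervalIntegrable (fun t : ℝ => t ^ (d - 1) * t ^ a) volume 0 1 := by
  have h := intervalIntegral.intervalIntegrable_rpow' (a := 0) (b := 1) (r := (d - 1 : ℕ) + a)
    (by rw [Nat.cast_sub (by omega)]; push_cast; linarith)
  refine h.congr fun t ht => ?_
  rw [Set.uIoc_of_le zero_le_one] at ht
  simp only [Real.rpow_add ht.1, Real.rpow_natCast]

/-- The integral over the conic surface with the weight `t ^ a`. -/
def weightedConeInt (d : ℕ) (a : ℝ) (g : E d × ℝ → ℝ) : ℝ :=
  ∫ t in (0 : ℝ)..1, (t ^ (d - 1) * t ^ a) * sphInt d fun ξ => g (t • ξ, t)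

lemma coneInt_mul_rpow {d : ℕ} (a : ℝ) (g : E d × ℝ → ℝ) :
    coneInt d (fun p => g p * p.2 ^ a) = weightedConeInt d a g := by
  rw [coneInt, weightedConeInt]
  congr 1 with t
  simp only [mul_comm (g _), sphInt_const_mul, mul_assoc]

lemma coneInner_eq {d : ℕ} (a : ℝ) (f g : E d × ℝ → ℝ) :
    coneInner d a 0 f g = coneConst d a 0 * weightedConeInt d a (f * g) := by
  rw [coneInner, ← coneInt_mul_rpow]
  simp only [Real.rpow_zero, mul_one, Pi.mul_apply]

lemma coneConst_pos {d : ℕ} (hd : 2 ≤ d) {a : ℝ} (ha : -(d : ℝ) < a) : 0 < coneConst d a 0 := by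
  have h1 := sphArea_pos hd
  have h2 := Real.Gamma_pos_of_pos (s := a + d + 0 + 1) (by linarith)
  have h3 := Real.Gamma_pos_of_pos (s := a + d) (by linarith)
  have h4 := Real.Gamma_pos_of_pos (s := (0 : ℝ) + 1) (by norm_num)
  unfold coneConst
  positivity

lemma intervalIntegrable_slice {d : ℕ} {a : ℝ} (ha : -(d : ℝ) < a) (hd : 2 ≤ d)
    {g : E d × ℝ → ℝ} (hg : ContinuousOn g (cone d)) :
    IntervalIntegrable (fun t : ℝ => (t ^ (d - 1) * t ^ a) * sphInt d fun ξ => g (t • ξ, t))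
      volume 0 1 :=
  (intervalIntegrable_weight ha hd).mul_continuousOn
    (by rw [Set.uIcc_of_le zero_le_one]; exact continuousOn_slice_sphInt hg)

lemma weightedConeInt_congr {d : ℕ} {a : ℝ} {f g : E d × ℝ → ℝ} (h : Set.EqOn f g (cone d)) :
    weightedConeInt d a f = weightedConeInt d a g := by
  refine intervalIntegral.integral_congr fun t ht => ?_
  rw [Set.uIcc_of_le zero_le_one] at ht
  exact congrArg _ (sphInt_congr fun ξ hξ => h (smul_sphere_mem_cone ht hξ))

lemma weightedConeInt_add {d : ℕ} (hd : 2 ≤ d) {a : ℝ} (ha : -(d : ℝ) < a) {f g : E d × ℝ → ℝ}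
    (hf : ContinuousOn f (cone d)) (hg : ContinuousOn g (cone d)) :
    weightedConeInt d a (f + g) = weightedConeInt d a f + weightedConeInt d a g := by
  rw [weightedConeInt, weightedConeInt, weightedConeInt, ← intervalIntegral.integral_add
    (intervalIntegrable_slice ha hd hf) (intervalIntegrable_slice ha hd hg)]
  refine intervalIntegral.integral_congr fun t ht => ?_
  rw [Set.uIcc_of_le zero_le_one] at ht
  simp only [Pi.add_apply]
  rw [sphInt_add (continuousOn_smul_sphere hf ht) (continuousOn_smul_sphere hg ht), mul_add]

lemma weightedConeInt_smul {d : ℕ} {a : ℝ} (c : ℝ) (f : E d × ℝ → ℝ) :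
    weightedConeInt d a (c • f) = c * weightedConeInt d a f := by
  rw [weightedConeInt, weightedConeInt, ← intervalIntegral.integral_const_mul]
  simp only [Pi.smul_apply, smul_eq_mul, sphInt_const_mul, mul_left_comm]

lemma coneInner_congr {d : ℕ} {a : ℝ} {f f' g g' : E d × ℝ → ℝ} (hf : Set.EqOn f f' (cone d))
    (hg : Set.EqOn g g' (cone d)) : coneInner d a 0 f g = coneInner d a 0 f' g' := by
  rw [coneInner_eq, coneInner_eq, weightedConeInt_congr fun p hp => by
    rw [Pi.mul_apply, hf hp, hg hp, ← Pi.mul_apply]]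

lemma isForm_coneInner {d : ℕ} (hd : 2 ≤ d) {a : ℝ} (ha : -(d : ℝ) < a) :
    IsForm (coneInner d a 0) (coneContinuous d) where
  symm f g := by rw [coneInner_eq, coneInner_eq, mul_comm f g]
  add_left f hf g hg h hh := by
    rw [coneInner_eq, coneInner_eq, coneInner_eq, add_mul,
      weightedConeInt_add hd ha (ContinuousOn.mul hf hh) (ContinuousOn.mul hg hh), mul_add]
  smul_left c f hf h hh := by
    rw [coneInner_eq, coneInner_eq, smul_mul_assoc, weightedConeInt_smul, mul_left_comm]

lemma coneInner_self_nonneg {d : ℕ} (hd : 2 ≤ d) {a : ℝ} (ha : -(d : ℝ) < a)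
    (f : E d × ℝ → ℝ) : 0 ≤ coneInner d a 0 f f := by
  rw [coneInner_eq]
  refine mul_nonneg (coneConst_pos hd ha).le
    (intervalIntegral.integral_nonneg zero_le_one fun t ht => ?_)
  have h1 : 0 ≤ t := ht.1
  have h2 : 0 ≤ sphInt d fun ξ => (f * f) (t • ξ, t) :=
    integral_nonneg fun ξ => mul_self_nonneg _
  positivity

/-- The weight is positive for 0 < t < 1, so the slice integrals of f² vanish almost everywhere
there, and everywhere by continuity. The open interval suffices for `conePoly_eq_zero`. -/
lemma eq_zero_of_coneInner_self {d : ℕ} (hd : 2 ≤ d) {a : ℝ} (ha : -(d : ℝ) < a)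
    {f : E d × ℝ → ℝ} (hf : f ∈ coneContinuous d) (h : coneInner d a 0 f f = 0) :
    ∀ t ∈ Set.Ioo (0 : ℝ) 1, ∀ ξ ∈ Metric.sphere (0 : E d) 1, f (t • ξ, t) = 0 := by
  rw [coneInner_eq] at h
  have h0 := (mul_eq_zero.mp h).resolve_left (coneConst_pos hd ha).ne'
  rw [weightedConeInt] at h0
  have hcont := continuousOn_slice_sphInt (ContinuousOn.mul hf hf)
  have hnn : ∀ t : ℝ, 0 ≤ sphInt d fun ξ => (f * f) (t • ξ, t) :=
    fun t => integral_nonneg fun ξ => mul_self_nonneg _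
  rw [intervalIntegral.integral_eq_zero_iff_of_le_of_nonneg_ae zero_le_one ?_
    (intervalIntegrable_slice ha hd (ContinuousOn.mul hf hf))] at h0
  · have h1 : (fun t : ℝ => sphInt d fun ξ => (f * f) (t • ξ, t))
        =ᵐ[volume.restrict (Set.Ioo 0 1)] 0 := by
      have := ae_restrict_of_ae_restrict_of_subset Set.Ioo_subset_Ioc_self h0
      filter_upwards [this, ae_restrict_mem measurableSet_Ioo] with t ht1 ht2
      have hpos : 0 < t ^ (d - 1) * t ^ a :=
        mul_pos (pow_pos ht2.1 _) (Real.rpow_pos_of_pos ht2.1 _)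
      exact (mul_eq_zero.mp ht1).resolve_left hpos.ne'
    have h2 := Measure.eqOn_open_of_ae_eq h1 isOpen_Ioo
      (hcont.mono Set.Ioo_subset_Icc_self) continuousOn_const
    intro t ht ξ hξ
    exact mul_self_eq_zero.mp (eqOn_zero_of_sphInt_eq_zero
      (continuousOn_smul_sphere (ContinuousOn.mul hf hf) (Set.Ioo_subset_Icc_self ht))
      (fun ξ _ => mul_self_nonneg _) (h2 ht) ξ hξ)
  · filter_upwards [ae_restrict_mem measurableSet_Ioc] with t ht
    exact mul_nonneg (mul_nonneg (pow_nonneg ht.1.le _) (Real.rpow_nonneg ht.1.le _)) (hnn t)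

lemma conePoly_le_coneContinuous (d N : ℕ) : conePoly d N ≤ coneContinuous d :=
  fun _ hg => (contDiff_of_mem_conePoly (n := 0) hg).continuous.continuousOn

lemma conePoly_definite {d N : ℕ} (hd : 2 ≤ d) {a : ℝ} (ha : -(d : ℝ) < a) {g : E d × ℝ → ℝ}
    (hg : g ∈ conePoly d N) (h : coneInner d a 0 g g = 0) : g = 0 :=
  conePoly_eq_zero hd hg
    (eq_zero_of_coneInner_self hd ha (conePoly_le_coneContinuous d N hg) h)

/-- The orthogonal polynomials of degree `n` as a subspace. -/
def orthPolySubmodule {d : ℕ} {B : (E d × ℝ → ℝ) → (E d × ℝ → ℝ) → ℝ}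
    {W : Submodule ℝ (E d × ℝ → ℝ)} (hB : IsForm B W) (hW : ∀ N, conePoly d N ≤ W) (n : ℕ) :
    Submodule ℝ (E d × ℝ → ℝ) where
  carrier := orthPoly d B n
  zero_mem' := ⟨Submodule.zero_mem _, fun _ hq => hB.zero_left (hW _ hq)⟩
  add_mem' := fun {f g} hf hg => ⟨Submodule.add_mem _ hf.1 hg.1, fun q hq => by
    rw [hB.add_left _ (hW _ hf.1) _ (hW _ hg.1) _ (hW _ hq), hf.2 q hq, hg.2 q hq, add_zero]⟩
  smul_mem' := fun c f hf => ⟨Submodule.smul_mem _ c hf.1, fun q hq => by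
    rw [hB.smul_left _ _ (hW _ hf.1) _ (hW _ hq), hf.2 q hq, mul_zero]⟩

lemma coneProj_spec {d : ℕ} (hd : 2 ≤ d) {a : ℝ} (ha : -(d : ℝ) < a) (n : ℕ)
    {g : E d × ℝ → ℝ} (hg : g ∈ coneContinuous d) :
    coneProj d a 0 n g ∈ orthPoly d (coneInner d a 0) n ∧
      ∀ q ∈ orthPoly d (coneInner d a 0) n, coneInner d a 0 (g - coneProj d a 0 n g) q = 0 := by
  let V := orthPolySubmodule (isForm_coneInner hd ha) (conePoly_le_coneContinuous d) n
  have hV : V ≤ conePoly d (n + 1) := fun _ h => h.1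
  have : FiniteDimensional ℝ V := Submodule.finiteDimensional_of_le hV
  exact (isForm_coneInner hd ha).orthProj_spec (V := V)
    (hV.trans (conePoly_le_coneContinuous d _)) (fun f hf h => conePoly_definite hd ha (hV hf) h) hg

/-! ### The Sobolev inner product -/

/-- Functions of class `C^s` near every point of the conic surface. -/
def coneSmooth (d s : ℕ) : Submodule ℝ (E d × ℝ → ℝ) where
  carrier := {f | ∀ p ∈ cone d, ContDiffAt ℝ s f p}
  zero_mem' := fun _ _ => contDiffAt_const
  add_mem' := fun hf hg p hp => (hf p hp).add (hg p hp)
  smul_mem' := fun _ _ hf p hp => contDiffAt_const.smul (hf p hp)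

lemma conePoly_le_coneSmooth (d s N : ℕ) : conePoly d N ≤ coneSmooth d s :=
  fun _ hg _ _ => (contDiff_of_mem_conePoly hg).contDiffAt

section

variable {d s k : ℕ} {f g : E d × ℝ → ℝ}

lemma tderiv_mem_coneContinuous (hk : k ≤ s) (hf : f ∈ coneSmooth d s) :
    tderiv k f ∈ coneContinuous d :=
  fun p hp => (continuousAt_tderiv hk (hf p hp)).continuousWithinAt

lemma base_mem_sphContinuous (hg : g ∈ coneContinuous d) :
    (fun ξ => g (ξ, 1)) ∈ sphContinuous d :=
  ContinuousOn.comp (g := g) (f := fun ξ : E d => (ξ, (1 : ℝ))) hg (by fun_prop)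
    fun _ hξ => sphere_mem_cone hξ

lemma tderiv_add_eqOn (hk : k ≤ s) (hf : f ∈ coneSmooth d s) (hg : g ∈ coneSmooth d s) :
    Set.EqOn (tderiv k (f + g)) (tderiv k f + tderiv k g) (cone d) := fun p hp =>
  tderiv_add ((hf p hp).of_le (by exact_mod_cast hk)) ((hg p hp).of_le (by exact_mod_cast hk))

lemma tderiv_sub_eqOn (hk : k ≤ s) (hf : f ∈ coneSmooth d s) (hg : g ∈ coneSmooth d s) :
    Set.EqOn (tderiv k (f - g)) (tderiv k f - tderiv k g) (cone d) := fun p hp => by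
  have h := tderiv_add_eqOn hk hf (Submodule.smul_mem _ (-1) hg) hp
  rw [neg_one_smul, ← sub_eq_add_neg] at h
  rw [h, ← neg_one_smul ℝ g, Pi.add_apply, tderiv_smul, Pi.sub_apply]
  ring

/-- The ratio of the constants of the two inner products on the conic surface. -/
def sobConst (d : ℕ) (a : ℝ) : ℝ := 1 / sphArea d / coneConst d a 0

lemma sobConst_pos (hd : 2 ≤ d) {a : ℝ} (ha : -(d : ℝ) < a) : 0 < sobConst d a := by
  have h1 := sphArea_pos hd
  have h2 := coneConst_pos hd ha
  unfold sobConst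
  positivity

/-- This direct sum decomposition reduces every statement on the Sobolev form to the cone form with
γ = 0 and to the sphere. -/
lemma sobInner_eq (hd : 2 ≤ d) {β : ℝ} (hβ : -(d : ℝ) < β + s) (lam : ℕ → ℝ)
    (f g : E d × ℝ → ℝ) :
    sobInner d s β lam f g =
      sobConst d (β + s) * coneInner d (β + s) 0 (tderiv s f) (tderiv s g) +
      ∑ k ∈ Finset.range s, lam k *
        sphInner d (fun ξ => tderiv k f (ξ, 1)) (fun ξ => tderiv k g (ξ, 1)) := by
  rw [sobInner, coneInner_eq, ← coneInt_mul_rpow, sobConst]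
  have h2 := (coneConst_pos hd hβ).ne'
  congr 1
  · rw [← mul_assoc, div_mul_cancel₀ _ h2]
    rfl
  · refine Finset.sum_congr rfl fun k _ => ?_
    rw [sphInner]
    ring

lemma isForm_sobInner (hd : 2 ≤ d) {β : ℝ} (hβ : -(d : ℝ) < β + s) (lam : ℕ → ℝ) :
    IsForm (sobInner d s β lam) (coneSmooth d s) where
  symm f g := by
    rw [sobInner_eq hd hβ, sobInner_eq hd hβ, (isForm_coneInner hd hβ).symm]
    simp only [(isForm_sphInner d).symm (fun ξ => tderiv _ f (ξ, 1))]
  add_left f hf g hg h hh := by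
    have hF := tderiv_mem_coneContinuous le_rfl hf
    have hG := tderiv_mem_coneContinuous le_rfl hg
    have hH := tderiv_mem_coneContinuous le_rfl hh
    rw [sobInner_eq hd hβ, sobInner_eq hd hβ, sobInner_eq hd hβ,
      coneInner_congr (tderiv_add_eqOn le_rfl hf hg) fun _ _ => rfl,
      (isForm_coneInner hd hβ).add_left _ hF _ hG _ hH, mul_add, add_add_add_comm,
      ← Finset.sum_add_distrib]
    congr 1
    refine Finset.sum_congr rfl fun k hk => ?_
    have hk : k ≤ s := (Finset.mem_range.mp hk).le
    have hF := base_mem_sphContinuous (tderiv_mem_coneContinuous hk hf)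
    have hG := base_mem_sphContinuous (tderiv_mem_coneContinuous hk hg)
    have hH := base_mem_sphContinuous (tderiv_mem_coneContinuous hk hh)
    rw [← mul_add, ← (isForm_sphInner d).add_left _ hF _ hG _ hH,
      sphInner_congr (fun ξ hξ => tderiv_add_eqOn hk hf hg (sphere_mem_cone hξ)) fun _ _ => rfl]
    rfl
  smul_left c f hf h hh := by
    have hF := tderiv_mem_coneContinuous le_rfl hf
    have hH := tderiv_mem_coneContinuous le_rfl hh
    have h1 : ∀ k, tderiv k (c • f) = c • tderiv k f := fun k => funext fun p => tderiv_smul c f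
    rw [sobInner_eq hd hβ, sobInner_eq hd hβ, h1, (isForm_coneInner hd hβ).smul_left c _ hF _ hH,
      mul_add, Finset.mul_sum, mul_left_comm]
    congr 1
    refine Finset.sum_congr rfl fun k hk => ?_
    have hk : k ≤ s := (Finset.mem_range.mp hk).le
    have hF := base_mem_sphContinuous (tderiv_mem_coneContinuous hk hf)
    have hH := base_mem_sphContinuous (tderiv_mem_coneContinuous hk hh)
    rw [h1, mul_left_comm, ← (isForm_sphInner d).smul_left c _ hF _ hH]
    rfl

/-- All summands are nonnegative, so all data of g vanish, and Taylor's formula at t = 1 recovers g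
from its data. -/
lemma conePoly_sob_definite (hd : 2 ≤ d) (hs : 1 ≤ s) {β : ℝ} (hβ : -(d : ℝ) < β + s)
    {lam : ℕ → ℝ} (hlam : ∀ k < s, 0 < lam k) {N : ℕ} (hg : g ∈ conePoly d N)
    (h : sobInner d s β lam g g = 0) : g = 0 := by
  rw [sobInner_eq hd hβ] at h
  have h1 : 0 ≤ sobConst d (β + s) * coneInner d (β + s) 0 (tderiv s g) (tderiv s g) :=
    mul_nonneg (sobConst_pos hd hβ).le (coneInner_self_nonneg hd hβ _)
  have h2 : ∀ k ∈ Finset.range s, 0 ≤ lam k *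
      sphInner d (fun ξ => tderiv k g (ξ, 1)) (fun ξ => tderiv k g (ξ, 1)) := fun k hk =>
    mul_nonneg (hlam k (Finset.mem_range.mp hk)).le (sphInner_self_nonneg _)
  obtain ⟨h3, h4⟩ := (add_eq_zero_iff_of_nonneg h1 (Finset.sum_nonneg h2)).mp h
  have h5 : tderiv s g = 0 := conePoly_definite hd hβ (tderiv_mem_conePoly s hg)
    ((mul_eq_zero.mp h3).resolve_left (sobConst_pos hd hβ).ne')
  have h6 : ∀ k < s, ∀ x, tderiv k g (x, 1) = 0 := fun k hk x => by
    have h7 := (Finset.sum_eq_zero_iff_of_nonneg h2).mp h4 k (Finset.mem_range.mpr hk)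
    exact congr_fun (harmonicLT_definite hd
      (slice_mem_harmonicLT (tderiv_mem_conePoly k hg) 1)
      ((mul_eq_zero.mp h7).resolve_left (hlam k hk).ne')) x
  ext ⟨x, t⟩
  rw [taylor_base_conePoly hs hg, h5, Finset.sum_eq_zero fun m hm => by
    rw [h6 m (Finset.mem_range.mp hm), mul_zero]]
  simp

end

/-! ### The Sobolev orthogonal polynomials -/

section

variable {d s : ℕ} {β : ℝ} {lam : ℕ → ℝ}

/-- A sufficient criterion for the orthogonality of polynomials. -/
lemma mem_orthPoly_sob (hd : 2 ≤ d) (hβ : -(d : ℝ) < β + s)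
    {k : ℕ} {P : E d × ℝ → ℝ} (hP : P ∈ conePoly d (k + 1))
    (h1 : s ≤ k → tderiv s P ∈ orthPoly d (coneInner d (β + s) 0) (k - s))
    (h2 : ∀ m < s, m ≤ k → (fun x => tderiv m P (x, 1)) ∈ harmonicSubmodule d (k - m)) :
    P ∈ orthPoly d (sobInner d s β lam) k := by
  refine ⟨hP, fun q hq => ?_⟩
  have hq' := tderiv_mem_conePoly s hq
  have hqc := conePoly_le_coneContinuous d _ hq'
  rw [sobInner_eq hd hβ]
  have e1 : coneInner d (β + s) 0 (tderiv s P) (tderiv s q) = 0 := by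
    -- If k < s, the s-th derivative of P vanishes for reasons of degree, so no projection of degree
    -- k - s enters.
    rcases Nat.lt_or_ge k s with hk | hk
    · have h0 := tderiv_mem_conePoly s hP
      rw [show k + 1 - s = 0 by omega, conePoly_zero_eq_bot, Submodule.mem_bot] at h0
      rw [h0]
      exact (isForm_coneInner hd hβ).zero_left hqc
    · exact (h1 hk).2 _ hq'
  rw [e1, mul_zero, zero_add]
  refine Finset.sum_eq_zero fun m hm => ?_
  have hm := Finset.mem_range.mp hm
  have hqm := slice_mem_harmonicLT (tderiv_mem_conePoly m hq) 1
  rcases Nat.lt_or_ge k m with hk | hk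
  · rw [show k - m = 0 by omega] at hqm
    have h0 : (fun x => tderiv m q (x, 1)) = 0 := hqm
    have h3 := slice_mem_harmonicLT (tderiv_mem_conePoly m hP) 1
    rw [h0, (isForm_sphInner d).zero_right (harmonicLT_le_sphContinuous _ _ h3), mul_zero]
  · rw [(isForm_sphInner d).symm, sphInner_harmonicLT_orthogonal hd le_rfl hqm (h2 m hm hk),
      mul_zero]

/-- Test q against the polynomial whose only nonzero datum is the m-th trace Y: the Sobolev form
reduces to λ_m times the pairing with Y. -/
lemma base_mem_of_mem_orthPoly_sob (hd : 2 ≤ d) (hβ : -(d : ℝ) < β + s)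
    (hlam : ∀ k < s, 0 < lam k) {k : ℕ} {q : E d × ℝ → ℝ}
    (hq : q ∈ orthPoly d (sobInner d s β lam) k) {m : ℕ} (hm : m < s) (hmk : m ≤ k) :
    (fun x => tderiv m q (x, 1)) ∈ harmonicSubmodule d (k - m) := by
  have h1 := slice_mem_harmonicLT (tderiv_mem_conePoly m hq.1) 1
  rw [show k + 1 - m = k - m + 1 by omega] at h1
  refine mem_harmonicSubmodule_of_orthogonal hd h1 fun Y hY => ?_
  obtain ⟨P, hP, hP1, hP2⟩ := exists_conePoly_data (N := k) s (Submodule.zero_mem _)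
    (fun l => if l = m then Y else 0) (fun l _ => by
      split_ifs with h
      · rw [h]; exact hY
      · exact Submodule.zero_mem _)
  have h2 := hq.2 P hP
  rw [sobInner_eq hd hβ, hP1, (isForm_coneInner hd hβ).zero_right
    (conePoly_le_coneContinuous d _ (tderiv_mem_conePoly s hq.1)), mul_zero, zero_add,
    Finset.sum_eq_single_of_mem m (Finset.mem_range.mpr hm)] at h2
  · have h3 : (fun ξ => tderiv m P (ξ, 1)) = Y := by
      ext x; simp [hP2 m hm x]
    rw [h3] at h2
    exact (mul_eq_zero.mp h2).resolve_left (hlam m hm).ne'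
  · intro l hl hlm
    have h3 : (fun ξ => tderiv l P (ξ, 1)) = 0 := by
      ext x; simp [hP2 l (Finset.mem_range.mp hl) x, hlm]
    rw [h3, (isForm_sphInner d).zero_right (harmonicLT_le_sphContinuous _ _
      (slice_mem_harmonicLT (tderiv_mem_conePoly l hq.1) 1)), mul_zero]

/-- Test q against polynomials with zero traces and arbitrary s-th derivative r. -/
lemma tderiv_mem_of_mem_orthPoly_sob (hd : 2 ≤ d) (hβ : -(d : ℝ) < β + s)
    {k : ℕ} {q : E d × ℝ → ℝ} (hq : q ∈ orthPoly d (sobInner d s β lam) k) (hk : s ≤ k) :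
    tderiv s q ∈ orthPoly d (coneInner d (β + s) 0) (k - s) := by
  have h1 := tderiv_mem_conePoly s hq.1
  rw [show k + 1 - s = k - s + 1 by omega] at h1
  refine ⟨h1, fun r hr => ?_⟩
  obtain ⟨P, hP, hP1, hP2⟩ := exists_conePoly_data (N := k) s hr 0
    (fun l _ => Submodule.zero_mem _)
  have h2 := hq.2 P hP
  rw [sobInner_eq hd hβ, hP1, Finset.sum_eq_zero, add_zero] at h2
  · exact (mul_eq_zero.mp h2).resolve_left (sobConst_pos hd hβ).ne'
  · intro l hl
    have h3 : (fun ξ => tderiv l P (ξ, 1)) = 0 := by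
      ext x; simp [hP2 l (Finset.mem_range.mp hl) x]
    rw [h3, (isForm_sphInner d).zero_right (harmonicLT_le_sphContinuous _ _
      (slice_mem_harmonicLT (tderiv_mem_conePoly l hq.1) 1)), mul_zero]

/-- The derivatives of the Sobolev projection are projections of the derivatives. -/
lemma sobProj_data (hd : 2 ≤ d) (hs : 1 ≤ s) (hβ : -(d : ℝ) < β + s)
    (hlam : ∀ k < s, 0 < lam k) {f : E d × ℝ → ℝ} (hf : f ∈ coneSmooth d s) (k : ℕ) :
    sobProj d s β lam k f ∈ conePoly d (k + 1) ∧
    tderiv s (sobProj d s β lam k f) =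
      (if s ≤ k then coneProj d (β + s) 0 (k - s) (tderiv s f) else 0) ∧
    ∀ m < s, ∀ x, tderiv m (sobProj d s β lam k f) (x, 1) =
      if m ≤ k then sphProj d (k - m) (fun ξ => tderiv m f (ξ, 1)) x else 0 := by
  have hFs := tderiv_mem_coneContinuous le_rfl hf
  have hFm : ∀ m < s, (fun ξ => tderiv m f (ξ, 1)) ∈ sphContinuous d := fun m hm =>
    base_mem_sphContinuous (tderiv_mem_coneContinuous hm.le hf)
  -- P is built from the projected data of f. It remains to see that P has the defining property of
  -- the Sobolev projection; existence of that projection comes for free.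
  obtain ⟨P, hP, hP1, hP2⟩ := exists_conePoly_data (N := k + 1) s
    (p := if s ≤ k then coneProj d (β + s) 0 (k - s) (tderiv s f) else 0) (by
      split_ifs with h
      · rw [show k + 1 - s = k - s + 1 by omega]
        exact (coneProj_spec hd hβ (k - s) hFs).1.1
      · exact Submodule.zero_mem _)
    (fun m => if m ≤ k then sphProj d (k - m) (fun ξ => tderiv m f (ξ, 1)) else 0)
    (fun m hm => by
      split_ifs with h
      · exact harmonicSubmodule_le (by omega) (sphProj_spec hd (k - m) (hFm m hm)).1
      · exact Submodule.zero_mem _)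
  have hbase : ∀ m < s, m ≤ k → (fun x => tderiv m P (x, 1)) =
      sphProj d (k - m) (fun ξ => tderiv m f (ξ, 1)) := fun m hm hk => by
    ext x; simp [hP2 m hm x, hk]
  have hPV : P ∈ orthPoly d (sobInner d s β lam) k := by
    refine mem_orthPoly_sob hd hβ hP (fun h => ?_) (fun m hm h => ?_)
    · rw [hP1, if_pos h]
      exact (coneProj_spec hd hβ (k - s) hFs).1
    · rw [hbase m hm h]
      exact (sphProj_spec hd (k - m) (hFm m hm)).1
  have hPW := conePoly_le_coneSmooth d s _ hP
  suffices hmain : sobProj d s β lam k f = P by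
    rw [hmain]
    refine ⟨hP, hP1, fun m hm x => ?_⟩
    rw [hP2 m hm x]
    split_ifs <;> rfl
  let V := orthPolySubmodule (isForm_sobInner hd hβ lam) (conePoly_le_coneSmooth d s) k
  have hV : V ≤ conePoly d (k + 1) := fun _ h => h.1
  refine (isForm_sobInner hd hβ lam).orthProj_eq (V := V)
    (hV.trans (conePoly_le_coneSmooth d s _))
    (fun g hg h => conePoly_sob_definite hd hs hβ hlam (hV hg) h) hf hPV fun q hq => ?_
  have hq : q ∈ orthPoly d (sobInner d s β lam) k := hq
  rw [sobInner_eq hd hβ, coneInner_congr (tderiv_sub_eqOn le_rfl hf hPW) fun _ _ => rfl]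
  have e1 : coneInner d (β + s) 0 (tderiv s f - tderiv s P) (tderiv s q) = 0 := by
    rcases Nat.lt_or_ge k s with hk | hk
    · have h0 := tderiv_mem_conePoly s hq.1
      rw [show k + 1 - s = 0 by omega, conePoly_zero_eq_bot, Submodule.mem_bot] at h0
      rw [h0]
      exact (isForm_coneInner hd hβ).zero_right
        (Submodule.sub_mem _ hFs (tderiv_mem_coneContinuous le_rfl hPW))
    · rw [hP1, if_pos hk]
      exact (coneProj_spec hd hβ (k - s) hFs).2 _ (tderiv_mem_of_mem_orthPoly_sob hd hβ hq hk)
  rw [e1, mul_zero, zero_add]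
  refine Finset.sum_eq_zero fun m hm => ?_
  have hm := Finset.mem_range.mp hm
  have hPm := base_mem_sphContinuous (tderiv_mem_coneContinuous hm.le hPW)
  have e2 : sphInner d (fun ξ => tderiv m (f - P) (ξ, 1)) (fun ξ => tderiv m q (ξ, 1)) =
      sphInner d ((fun ξ => tderiv m f (ξ, 1)) - fun ξ => tderiv m P (ξ, 1))
        (fun ξ => tderiv m q (ξ, 1)) :=
    sphInner_congr (fun ξ hξ => tderiv_sub_eqOn hm.le hf hPW (sphere_mem_cone hξ)) fun _ _ => rfl
  rw [e2]
  rcases Nat.lt_or_ge k m with hk | hk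
  · have hqm := slice_mem_harmonicLT (tderiv_mem_conePoly m hq.1) 1
    rw [show k + 1 - m = 0 by omega] at hqm
    have h0 : (fun x => tderiv m q (x, 1)) = 0 := hqm
    rw [h0, (isForm_sphInner d).zero_right (Submodule.sub_mem _ (hFm m hm) hPm), mul_zero]
  · rw [hbase m hm hk, (sphProj_spec hd (k - m) (hFm m hm)).2 _
      (base_mem_of_mem_orthPoly_sob hd hβ hlam hq hm hk), mul_zero]

/-! ### Compatibility of the cut-off sums with differentiation. -/

/-- A sum over degrees, shifted by `m`. -/
lemma sum_range_shift (n m : ℕ) (η : ℝ → ℝ) (c : ℝ) (F : ℕ → ℝ) :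
    ∑ k ∈ Finset.range (n + 1), η ((k : ℝ) / c) * (if m ≤ k then F (k - m) else 0) =
      ∑ j ∈ Finset.range (n + 1 - m), η (((j : ℝ) + m) / c) * F j := by
  rw [← Finset.sum_filter_add_sum_filter_not _ (fun k => m ≤ k)]
  rw [Finset.sum_eq_zero (s := Finset.filter (fun k => ¬ m ≤ k) _) fun k hk => by
    rw [if_neg (Finset.mem_filter.mp hk).2, mul_zero], add_zero]
  refine Finset.sum_bij' (fun k _ => k - m) (fun j _ => j + m) ?_ ?_ ?_ ?_ ?_
  · intro k hk; simp only [Finset.mem_filter, Finset.mem_range] at hk ⊢; omega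
  · intro k hk; simp only [Finset.mem_filter, Finset.mem_range] at hk ⊢; omega
  · intro k hk; simp only [Finset.mem_filter] at hk; omega
  · intro k hk; simp
  · intro k hk
    have h := (Finset.mem_filter.mp hk).2
    rw [if_pos h, Nat.cast_sub h, sub_add_cancel]

lemma tderiv_sum_smul {N M k : ℕ} {c : ℕ → ℝ} {g : ℕ → E d × ℝ → ℝ}
    (hg : ∀ i < N, g i ∈ conePoly d M) :
    (∑ i ∈ Finset.range N, c i • g i) ∈ conePoly d M ∧
    tderiv k (∑ i ∈ Finset.range N, c i • g i) = ∑ i ∈ Finset.range N, c i • tderiv k (g i) := by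
  induction N with
  | zero => simp [tderiv_zero_fun]
  | succ N ih =>
    obtain ⟨h1, h2⟩ := ih fun i hi => hg i (by omega)
    have h3 := Submodule.smul_mem _ (c N) (hg N (by omega))
    rw [Finset.sum_range_succ, Finset.sum_range_succ]
    refine ⟨Submodule.add_mem _ h1 h3, ?_⟩
    rw [tderiv_add_of_mem h1 h3, h2]
    congr 1
    exact funext fun p => tderiv_smul _ _

/-- The derivatives of the near best approximation are near best approximations of the
derivatives. -/
lemma sobQ_data (hd : 2 ≤ d) (hs : 1 ≤ s) (hβ : -(d : ℝ) < β + s)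
    (hlam : ∀ k < s, 0 < lam k) (η : ℝ → ℝ) (n : ℕ) {f : E d × ℝ → ℝ}
    (hf : f ∈ coneSmooth d s) :
    sobQ d s β lam η n f ∈ conePoly d (2 * n + 1) ∧
    tderiv s (sobQ d s β lam η n f) = coneQ d (β + s) 0 η n s (tderiv s f) ∧
    ∀ m < s, ∀ x, tderiv m (sobQ d s β lam η n f) (x, 1) =
      sphQ d η n m (fun ξ => tderiv m f (ξ, 1)) x := by
  have hdata := sobProj_data hd hs hβ hlam hf
  have hg : ∀ i < 2 * n + 1, sobProj d s β lam i f ∈ conePoly d (2 * n + 1) := fun i hi =>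
    conePoly_mono (by omega) (hdata i).1
  refine ⟨(tderiv_sum_smul (k := 0) hg).1, ?_, fun m hm x => ?_⟩
  · rw [sobQ, (tderiv_sum_smul hg).2, coneQ]
    ext p
    simp only [Finset.sum_apply, Pi.smul_apply, smul_eq_mul]
    rw [← sum_range_shift (2 * n) s η n fun j => coneProj d (β + s) 0 j (tderiv s f) p]
    refine Finset.sum_congr rfl fun k _ => ?_
    rw [(hdata k).2.1]
    split_ifs <;> rfl
  · rw [sobQ, (tderiv_sum_smul hg).2, sphQ]
    simp only [Finset.sum_apply, Pi.smul_apply, smul_eq_mul]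
    rw [← sum_range_shift (2 * n) m η n fun j => sphProj d j (fun ξ => tderiv m f (ξ, 1)) x]
    refine Finset.sum_congr rfl fun k _ => ?_
    rw [(hdata k).2.2 m hm]

end

lemma cone_subset_solidCone (d : ℕ) : cone d ⊆ solidCone d := fun _ h => ⟨h.1.le, h.2.2⟩

end ConeSobolev

end

/-! ### The error formula. -/

theorem mainTheorem6 (d : ℕ) (hd : 2 ≤ d) (s : ℕ) (hs : 1 ≤ s) (β : ℝ)
    (hβ : -(d : ℝ) - (s : ℝ) < β) (lam : ℕ → ℝ) (hlam : ∀ k < s, 0 < lam k)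
    (η : ℝ → ℝ) (hη : ConeSobolev.IsAdmissibleCutoff η) (n : ℕ) (hn : 1 ≤ n)
    (U : Set (ConeSobolev.E d × ℝ)) (hU : IsOpen U) (hUc : ConeSobolev.solidCone d ⊆ U)
    (f : ConeSobolev.E d × ℝ → ℝ) (hf : ContDiffOn ℝ s f U)
    (x : ConeSobolev.E d) (t : ℝ) (hxt : (x, t) ∈ ConeSobolev.cone d) :
    f (x, t) - ConeSobolev.sobQ d s β lam η n f (x, t) =
      (∑ m ∈ Finset.range s, (t - 1) ^ m / (Nat.factorial m : ℝ) *
        (ConeSobolev.tderiv m f (x, 1) -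
          ConeSobolev.sphQ d η n m (fun ξ => ConeSobolev.tderiv m f (ξ, 1)) x)) +
      (-1 : ℝ) ^ s * ∫ v in t..1, (v - t) ^ (s - 1) / (Nat.factorial (s - 1) : ℝ) *
        (ConeSobolev.tderiv s f (x, v) -
          ConeSobolev.coneQ d (β + s) 0 η n s (ConeSobolev.tderiv s f) (x, v)) := by
  have hsm : ∀ p ∈ ConeSobolev.solidCone d, ContDiffAt ℝ s f p := fun p hp =>
    hf.contDiffAt (hU.mem_nhds (hUc hp))
  have hfW : f ∈ ConeSobolev.coneSmooth d s := fun p hp =>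
    hsm p (ConeSobolev.cone_subset_solidCone d hp)
  obtain ⟨hQ, hQ1, hQ2⟩ :=
    ConeSobolev.sobQ_data hd hs (β := β) (by linarith) hlam η n hfW
  -- Since ‖x‖ = t ≤ v ≤ 1, the segment lies in the solid cone.
  have hseg : ∀ v ∈ Set.uIcc 1 t, ContDiffAt ℝ s f (x, v) := fun v hv => by
    rw [Set.uIcc_of_ge hxt.2.2] at hv
    exact hsm _ ⟨hxt.1.le.trans hv.1, hv.2⟩
  have hQs := ConeSobolev.contDiff_of_mem_conePoly hQ (n := s)
  have hint : ∀ g : ConeSobolev.E d × ℝ → ℝ, (∀ v ∈ Set.uIcc 1 t, ContDiffAt ℝ s g (x, v)) →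
      IntervalIntegrable (fun v => (v - t) ^ (s - 1) / (Nat.factorial (s - 1) : ℝ) *
        ConeSobolev.tderiv s g (x, v)) MeasureTheory.volume t 1 := fun g hg => by
    refine ContinuousOn.intervalIntegrable fun v hv => ContinuousAt.continuousWithinAt ?_
    rw [Set.uIcc_comm] at hv
    refine ContinuousAt.mul (by fun_prop) ?_
    exact ContinuousAt.comp (g := ConeSobolev.tderiv s g) (f := fun v : ℝ => (x, v))
      (ConeSobolev.continuousAt_tderiv le_rfl (hg v hv)) (by fun_prop)
  rw [ConeSobolev.taylor_base hs x t hseg, ConeSobolev.taylor_base_conePoly hs hQ x t,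
    add_sub_add_comm, ← Finset.sum_sub_distrib, ← mul_sub, ← intervalIntegral.integral_sub
    (hint f hseg) (hint _ fun v _ => hQs.contDiffAt), hQ1]
  simp only [← mul_sub]
  congr 1
  refine Finset.sum_congr rfl fun m hm => ?_
  rw [hQ2 m (Finset.mem_range.mp hm)]
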